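/- Let $\alpha,\beta\in\mathbb R$ be such that $1,\alpha,\beta$ are linearly independent over $\mathbb Q$, let $\mathbb T^1=\mathbb R/\mathbb Z$, let $\rho:\mathbb T^1\to\mathbb C$ be continuous, and let $F:\mathbb T^1\times\mathbb C\to\mathbb T^1\times\mathbb C$ be the map $F(x,z)=(x+\alpha,\,e^{2\pi i\beta}z+\rho(x))$. For $n\ge 0$ define $\rho_n:\mathbb T^1\to\mathbb C$ by $F^n(x,z)=(x+n\alpha,\,e^{2\pi i n\beta}z+\rho_n(x))$. Then: (1) $\rho_n(x)/n\to 0$ as $n\to\infty$, uniformly in $x\in\mathbb T^1$. In particular $F$ has zero drift: for every probability measure $\mu$ on $\mathbb T^1$ that is invariant and ergodic under $x\mapsto x+\alpha$, one has $\lim_{n\to\infty}|\rho_n(x)|/n=0$ for $\mu$-almost every $x$. (2) $F$ is conservative in the topological sense: it has no wandering open set, that is, there is no nonempty open set $U\subset\mathbb T^1\times\mathbb C$ with $F^n(U)\cap U=\emptyset$ for all $n\ge 1$. -/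

import Mathlib

open Filter Topology MeasureTheory

noncomputable section

/-- The circle `𝕋¹ = ℝ / ℤ` is `UnitAddCircle`. The skew product
`F (x, z) = (x + α, e^{2πiβ} z + ρ x)` on `𝕋¹ × ℂ`. -/
def vortex (α β : ℝ) (ρ : UnitAddCircle → ℂ) (p : UnitAddCircle × ℂ) : UnitAddCircle × ℂ :=
  (p.1 + (α : UnitAddCircle), Complex.exp (2 * Real.pi * Complex.I * β) * p.2 + ρ p.1)

/-- The translation part `ρₙ` of the `n`-th iterate of `F`, that is, the function with
`Fⁿ (x, z) = (x + nα, e^{2πinβ} z + ρₙ x)` (see `vortex_iterate`). -/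
def vortexSum (α β : ℝ) (ρ : UnitAddCircle → ℂ) (n : ℕ) (x : UnitAddCircle) : ℂ :=
  ((vortex α β ρ)^[n] (x, 0)).2

theorem vortex_iterate (α β : ℝ) (ρ : UnitAddCircle → ℂ) (n : ℕ) (x : UnitAddCircle) (z : ℂ) :
    (vortex α β ρ)^[n] (x, z) =
      (x + n • (α : UnitAddCircle),
        Complex.exp (2 * Real.pi * Complex.I * (n * β)) * z + vortexSum α β ρ n x) := by
  have key : ∀ w : ℂ, ((vortex α β ρ)^[n] (x, w)).1 = x + n • (α : UnitAddCircle) ∧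
      ((vortex α β ρ)^[n] (x, w)).2 =
        Complex.exp (2 * Real.pi * Complex.I * (n * β)) * w + vortexSum α β ρ n x := by
    intro w
    induction n with
    | zero => simp [vortexSum]
    | succ k ih =>
      have h0 : ((vortex α β ρ)^[k] (x, 0)).1 = ((vortex α β ρ)^[k] (x, w)).1 := by
        rw [ih.1]
        clear ih
        induction k with
        | zero => simp
        | succ j ihj => rw [Function.iterate_succ_apply']; simp [vortex, ihj, add_smul, add_assoc]
      have hs : vortexSum α β ρ (k + 1) x =
          Complex.exp (2 * Real.pi * Complex.I * β) * vortexSum α β ρ k x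
            + ρ ((vortex α β ρ)^[k] (x, w)).1 := by
        simp only [vortexSum, Function.iterate_succ_apply', vortex]
        rw [← h0]
      rw [Function.iterate_succ_apply']
      refine ⟨?_, ?_⟩
      · simp [vortex, ih.1, add_smul, add_assoc]
      · rw [hs]
        simp only [vortex]
        rw [ih.2]
        have he : Complex.exp (2 * Real.pi * Complex.I * (((k + 1 : ℕ) : ℂ) * β)) =
            Complex.exp (2 * Real.pi * Complex.I * β) *
              Complex.exp (2 * Real.pi * Complex.I * (k * β)) := by
          rw [← Complex.exp_add]; congr 1; push_cast; ring
        rw [he]; ring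
  exact Prod.ext (key z).1 (key z).2

/-- `F` has zero drift: for every probability measure `μ` that is invariant and ergodic for the
rotation `x ↦ x + α`, the drift `lim ‖ρₙ x‖ / n` exists and is `0` for `μ`-almost every `x`. -/
def HasZeroDrift (α β : ℝ) (ρ : UnitAddCircle → ℂ) : Prop :=
  ∀ μ : Measure UnitAddCircle, IsProbabilityMeasure μ →
    Ergodic (fun x : UnitAddCircle => x + (α : UnitAddCircle)) μ →
      ∀ᵐ x ∂μ, Tendsto (fun n : ℕ => ‖vortexSum α β ρ n x‖ / n) atTop (𝓝 0)

/-- A wandering open set of a map: a nonempty open set that none of its forward images meets. -/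
def IsWanderingOpen {X : Type*} [TopologicalSpace X] (f : X → X) (U : Set X) : Prop :=
  IsOpen U ∧ U.Nonempty ∧ ∀ n : ℕ, 1 ≤ n → Disjoint (f^[n] '' U) U

/-- Topological conservativity: there is no wandering open set. -/
def IsTopConservative {X : Type*} [TopologicalSpace X] (f : X → X) : Prop :=
  ∀ U : Set X, ¬ IsWanderingOpen f U

end

/-! Put `E = exp(-2πiβ)` and let `u_n = E^n ρ_n`, which is the twisted Birkhoff sum of `Eρ`
(`twistedSum`). Uniform convergence is Weyl's argument: for a character the twisted sum is a
geometric series of ratio `E e^{2πikα} ≠ 1`, hence bounded, and trigonometric polynomials are dense.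

For conservativity, call `n` a return time if `nα` is near `0` and `E^n` is near `1`. A wandering
open set, together with minimality of the rotation, forces `|u_n| ≥ r > 0` on the whole circle at
all return times `n ≥ 1` (`IsEscaping`). Hence `u_n` has a winding number `d_n`. Since `E u_n(x +
α)` is close to `u_n(x)`, the argument of `u_n` along an orbit turns at mean rate `2π(d_n α - β -
k)` for some integer `k`, which is nonzero. At finer return times the step, hence the rate, tends to
zero. This is absurd if only finitely many `d_n` occur (`IsEscaping.false`).

Finiteness follows because adding a fixed return time `l` does not change `d_n` for large `n`
(`IsEscaping.exists_winding_eq`), and return times have bounded gaps. Write `u_{n+l} = u_n + B` with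
`B` bounded independently of `n`. If the winding numbers differ, some short arc of the curve `u_n`,
with far endpoints, separates `0` from `-B`. Following the dynamics moves these two points along
discrete paths that never come near the arc, so they remain separated; yet their difference is, up
to sign and a unimodular factor, `u_l` along an orbit, which rotates at a nonzero mean rate. Planar
topology bounds the duration of such a motion (`exists_length_bound`): two separated loops do not
wind about each other, so simultaneous returns are ruled out after a fixed time, the paths spend
bounded time in any disc of given radius, and distant points contribute little rotation. -/

/-! ### Logarithmic increments and the index of a polygon. -/

theorem norm_log_div_le {a b : ℂ} (ha : a ≠ 0) (h : ‖b - a‖ ≤ ‖a‖ / 2) :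
    ‖Complex.log (b / a)‖ ≤ 3 / 2 * (‖b - a‖ / ‖a‖) := by
  have ha' : 0 < ‖a‖ := norm_pos_iff.mpr ha
  have e : b / a = 1 + (b - a) / a := by field_simp; ring
  have hn : ‖(b - a) / a‖ = ‖b - a‖ / ‖a‖ := norm_div _ _
  rw [e, ← hn]
  apply Complex.norm_log_one_add_half_le_self
  rw [hn, div_le_iff₀ ha']
  linarith

/-- The principal branch is additive as long as the imaginary part of the sum stays inside `(-π,
π)`. -/
theorem log_div_trans {a b c : ℂ} (ha : a ≠ 0) (hb : b ≠ 0) (hc : c ≠ 0)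
    (h : ‖Complex.log (b / a)‖ + ‖Complex.log (c / b)‖ < Real.pi) :
    Complex.log (c / a) = Complex.log (b / a) + Complex.log (c / b) := by
  have h1 := Complex.abs_im_le_norm (Complex.log (b / a) + Complex.log (c / b))
  have h2 := norm_add_le (Complex.log (b / a)) (Complex.log (c / b))
  have h3 := abs_lt.mp (lt_of_le_of_lt (h1.trans h2) h)
  rw [← Complex.log_exp h3.1 h3.2.le, Complex.exp_add, Complex.exp_log (div_ne_zero hb ha),
    Complex.exp_log (div_ne_zero hc hb)]
  congr 1
  field_simp

theorem norm_log_div_le_of_quarter {a b : ℂ} (ha : a ≠ 0) (h : ‖b - a‖ ≤ ‖a‖ / 4) :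
    ‖Complex.log (b / a)‖ ≤ 3 / 8 := by
  have ha' : 0 < ‖a‖ := norm_pos_iff.mpr ha
  refine (norm_log_div_le ha (by linarith)).trans ?_
  have : ‖b - a‖ / ‖a‖ ≤ 1 / 4 := by
    rw [div_le_iff₀ ha']; linarith
  linarith

/-- On a grid where neighbouring values have small logarithmic ratios, the logarithmic increment
along the diagonal agrees with the one along two sides. -/
theorem sum_log_diag_eq (w : ℕ → ℕ → ℂ) (N : ℕ)
    (h0 : ∀ i ≤ N, ∀ j ≤ N, w i j ≠ 0)
    (h1 : ∀ i < N, ∀ j ≤ N, ‖w (i + 1) j - w i j‖ ≤ ‖w i j‖ / 4)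
    (h2 : ∀ i ≤ N, ∀ j < N, ‖w i (j + 1) - w i j‖ ≤ ‖w i j‖ / 4) :
    ∑ b ∈ Finset.range N, Complex.log (w (b + 1) (b + 1) / w b b) =
      ∑ j ∈ Finset.range N, Complex.log (w N (j + 1) / w N j) +
        ∑ i ∈ Finset.range N, Complex.log (w (i + 1) 0 / w i 0) := by
  have hpi := Real.pi_gt_three
  have e1 : ∀ i < N, ∀ j < N, Complex.log (w (i + 1) (j + 1) / w i j) =
      Complex.log (w i (j + 1) / w i j) + Complex.log (w (i + 1) (j + 1) / w i (j + 1)) := by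
    intro i hi j hj
    apply log_div_trans (h0 _ hi.le _ hj.le) (h0 _ hi.le _ hj) (h0 _ hi _ hj)
    have a1 := norm_log_div_le_of_quarter (h0 _ hi.le _ hj.le) (h2 i hi.le j hj)
    have a2 := norm_log_div_le_of_quarter (h0 _ hi.le _ hj) (h1 i hi (j + 1) hj)
    linarith
  have e2 : ∀ i < N, ∀ j < N, Complex.log (w (i + 1) (j + 1) / w i j) =
      Complex.log (w (i + 1) j / w i j) + Complex.log (w (i + 1) (j + 1) / w (i + 1) j) := by
    intro i hi j hj
    apply log_div_trans (h0 _ hi.le _ hj.le) (h0 _ hi _ hj.le) (h0 _ hi _ hj)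
    have a1 := norm_log_div_le_of_quarter (h0 _ hi.le _ hj.le) (h1 i hi j hj.le)
    have a2 := norm_log_div_le_of_quarter (h0 _ hi _ hj.le) (h2 (i + 1) hi j hj)
    linarith
  -- Discrete homotopy: `e1` and `e2` say that the increment around each grid cell vanishes; `key`
  -- sums this over a row, and `main` over the rows.
  have key : ∀ i < N, ∀ m ≤ N,
      ∑ j ∈ Finset.range m, Complex.log (w (i + 1) (j + 1) / w (i + 1) j) +
        Complex.log (w (i + 1) 0 / w i 0) =
      ∑ j ∈ Finset.range m, Complex.log (w i (j + 1) / w i j) +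
        Complex.log (w (i + 1) m / w i m) := by
    intro i hi m hm
    induction m with
    | zero => simp
    | succ m ih =>
      rw [Finset.sum_range_succ, Finset.sum_range_succ]
      linear_combination ih (by omega) + e1 i hi m hm - e2 i hi m hm
  have main : ∀ m ≤ N, ∑ b ∈ Finset.range m, Complex.log (w (b + 1) (b + 1) / w b b) =
      ∑ j ∈ Finset.range m, Complex.log (w m (j + 1) / w m j) +
        ∑ i ∈ Finset.range m, Complex.log (w (i + 1) 0 / w i 0) := by
    intro m hm
    induction m with
    | zero => simp
    | succ m ih =>
      have k := key m hm m (by omega)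
      rw [Finset.sum_range_succ, Finset.sum_range_succ _ m, Finset.sum_range_succ _ m]
      linear_combination ih (by omega) - k + e2 m hm m hm
  exact main N le_rfl

/-- The values lie in `2πiℤ`; two distinct ones would force a half-integer multiple in between. -/
theorem eq_of_exp_eq_one {X : Type*} [TopologicalSpace X] {S : Set X} (hS : IsPreconnected S)
    {f : X → ℂ} (hf : ContinuousOn f S) (h1 : ∀ x ∈ S, Complex.exp (f x) = 1)
    {x y : X} (hx : x ∈ S) (hy : y ∈ S) : f x = f y := by
  have hint : ∀ x ∈ S, ∃ n : ℤ, f x = n * (2 * Real.pi * Complex.I) := fun x hx =>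
    Complex.exp_eq_one_iff.mp (h1 x hx)
  have hpi := Real.pi_pos
  have hcont : ContinuousOn (fun x => (f x).im / (2 * Real.pi)) S :=
    (Complex.continuous_im.comp_continuousOn hf).div_const _
  have hval : ∀ x ∈ S, ∃ n : ℤ, (f x).im / (2 * Real.pi) = n := by
    intro x hx
    obtain ⟨n, hn⟩ := hint x hx
    refine ⟨n, ?_⟩
    rw [hn]
    simp
  have hr := hS.image _ hcont
  have : (f x).im / (2 * Real.pi) = (f y).im / (2 * Real.pi) := by
    obtain ⟨n, hn⟩ := hval x hx
    obtain ⟨m, hm⟩ := hval y hy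
    by_contra hne
    wlog hlt : n < m generalizing x y n m
    · refine this hy hx m hm n hn (fun h => hne h.symm) ?_
      rcases lt_trichotomy n m with h | h | h
      · exact absurd h hlt
      · exact absurd (by rw [hn, hm, h]) hne
      · exact h
    have hc : ((n : ℝ) + 1 / 2) ∈ (fun x => (f x).im / (2 * Real.pi)) '' S := by
      apply hr.Icc_subset ⟨x, hx, hn⟩ ⟨y, hy, hm⟩
      have : (n : ℝ) + 1 ≤ m := by exact_mod_cast hlt
      constructor <;> linarith
    obtain ⟨z, hz, hzz⟩ := hc
    obtain ⟨k, hk⟩ := hval z hz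
    simp only at hzz
    rw [hk] at hzz
    have : (2 * k : ℤ) = 2 * n + 1 := by
      have : (2 * k : ℝ) = 2 * n + 1 := by linarith
      exact_mod_cast this
    omega
  obtain ⟨n, hn⟩ := hint x hx
  obtain ⟨m, hm⟩ := hint y hy
  rw [hn, hm] at this
  rw [hn, hm]
  simp at this
  rw [this]

/-- The logarithmic increment of a polygon around a point. -/
noncomputable def polyIndex (Q : ℕ → ℂ) (m : ℕ) (q : ℂ) : ℂ :=
  ∑ j ∈ Finset.range m, Complex.log ((Q (j + 1) - q) / (Q j - q))

theorem exp_polyIndex {Q : ℕ → ℂ} {m : ℕ} (hQ : Q m = Q 0) {q : ℂ}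
    (h : ∀ j ≤ m, Q j - q ≠ 0) : Complex.exp (polyIndex Q m q) = 1 := by
  have : ∀ k ≤ m, Complex.exp (polyIndex Q k q) = (Q k - q) / (Q 0 - q) := by
    intro k hk
    induction k with
    | zero => simp [polyIndex, div_self (h 0 hk)]
    | succ k ih =>
      have e : polyIndex Q (k + 1) q =
          polyIndex Q k q + Complex.log ((Q (k + 1) - q) / (Q k - q)) := by
        simp [polyIndex, Finset.sum_range_succ]
      have hk' := h k (by omega)
      have h0 := h 0 (by omega)
      rw [e, Complex.exp_add, ih (by omega), Complex.exp_log (div_ne_zero (h _ hk) hk')]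
      field_simp
  rw [this m le_rfl, hQ, div_self (h 0 (by omega))]

theorem mem_slitPlane_div {a b : ℂ} (h : ‖b - a‖ < ‖a‖) : b / a ∈ Complex.slitPlane := by
  have ha' : 0 < ‖a‖ := (norm_nonneg _).trans_lt h
  have ha : a ≠ 0 := norm_pos_iff.mp ha'
  have e : b / a = 1 + (b - a) / a := by field_simp; ring
  rw [e]
  apply Complex.mem_slitPlane_of_norm_lt_one
  rw [norm_div, div_lt_one ha']
  exact h

theorem continuousOn_polyIndex {Q : ℕ → ℂ} {m : ℕ} {S : Set ℂ}
    (h : ∀ q ∈ S, ∀ j < m, ‖Q (j + 1) - Q j‖ < ‖Q j - q‖) :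
    ContinuousOn (polyIndex Q m) S := by
  unfold polyIndex
  refine continuousOn_finsetSum _ fun j hj => ?_
  have hj' := Finset.mem_range.mp hj
  refine ContinuousOn.clog (ContinuousOn.div (by fun_prop) (by fun_prop) ?_) ?_
  · intro q hq
    exact norm_pos_iff.mp ((norm_nonneg _).trans_lt (h q hq j hj'))
  · intro q hq
    apply mem_slitPlane_div
    simpa using h q hq j hj'

/-- All `1 - Q j / q` lie in the right half-plane, where the principal logarithm of a quotient is
the difference of logarithms, so the sum telescopes. -/
theorem polyIndex_eq_zero_of_far {Q : ℕ → ℂ} {m : ℕ} (hQ : Q m = Q 0) {q : ℂ}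
    (h : ∀ j ≤ m, ‖Q j‖ < ‖q‖) : polyIndex Q m q = 0 := by
  have hq' : 0 < ‖q‖ := (norm_nonneg _).trans_lt (h 0 (by omega))
  have hq : q ≠ 0 := norm_pos_iff.mp hq'
  have hre : ∀ j ≤ m, 0 < (1 - Q j / q).re := by
    intro j hj
    have h1 : ‖Q j / q‖ < 1 := by
      rw [norm_div, div_lt_one hq']; exact h j hj
    have := (Complex.re_le_norm (Q j / q)).trans_lt h1
    simp only [Complex.sub_re, Complex.one_re]
    linarith
  have hterm : ∀ j < m, Complex.log ((Q (j + 1) - q) / (Q j - q)) =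
      Complex.log (1 - Q (j + 1) / q) - Complex.log (1 - Q j / q) := by
    intro j hj
    have r1 := hre (j + 1) hj
    have r0 := hre j hj.le
    have n1 : (1 - Q (j + 1) / q) ≠ 0 := fun h => by rw [h] at r1; simp at r1
    have n0 : (1 - Q j / q) ≠ 0 := fun h => by rw [h] at r0; simp at r0
    have a1 := abs_lt.mp (Complex.abs_arg_lt_pi_div_two_iff.mpr (Or.inl r1))
    have a0 := abs_lt.mp (Complex.abs_arg_lt_pi_div_two_iff.mpr (Or.inl r0))
    have e : (Q (j + 1) - q) / (Q j - q) = (1 - Q (j + 1) / q) / (1 - Q j / q) := by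
      have h1 : Q (j + 1) - q = -q * (1 - Q (j + 1) / q) := by field_simp; ring
      have h2 : Q j - q = -q * (1 - Q j / q) := by field_simp; ring
      rw [h1, h2, mul_div_mul_left _ _ (neg_ne_zero.mpr hq)]
    rw [e, ← Complex.exp_log n1, ← Complex.exp_log n0, ← Complex.exp_sub, Complex.log_exp,
      Complex.exp_log n1, Complex.exp_log n0]
    · simp only [Complex.sub_im, Complex.log_im]; linarith
    · simp only [Complex.sub_im, Complex.log_im]; linarith
  rw [polyIndex, Finset.sum_congr rfl fun j hj => hterm j (Finset.mem_range.mp hj),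
    Finset.sum_range_sub (fun j => Complex.log (1 - Q j / q)), hQ, sub_self]

theorem polyIndex_eq_of_isPreconnected {Q : ℕ → ℂ} {m : ℕ} (hQ : Q m = Q 0) {S : Set ℂ}
    (hS : IsPreconnected S) {δ : ℝ} (hstep : ∀ j < m, ‖Q (j + 1) - Q j‖ < δ)
    (hδ : 0 < δ) (h : ∀ q ∈ S, ∀ j ≤ m, δ ≤ ‖Q j - q‖) {p q : ℂ} (hp : p ∈ S) (hq : q ∈ S) :
    polyIndex Q m p = polyIndex Q m q :=
  eq_of_exp_eq_one hS
    (continuousOn_polyIndex fun q hq j hj => (hstep j hj).trans_le (h q hq j hj.le))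
    (fun q hq => exp_polyIndex hQ fun j hj => norm_pos_iff.mp (hδ.trans_le (h q hq j hj))) hp hq

/-! ### Sides of a path with far endpoints. -/

/-- Two points are on the same side of the path `v` on `[y₀, y₁]`, whose endpoints are far away:
the ratio `(v - q) / (v - p)` has a continuous logarithm which is principal at the endpoints. -/
def SameSide (v : ℝ → ℂ) (y₀ y₁ : ℝ) (p q : ℂ) : Prop :=
  ∃ H : ℝ → ℂ, ContinuousOn H (Set.Icc y₀ y₁) ∧
    (∀ x ∈ Set.Icc y₀ y₁, Complex.exp (H x) = (v x - q) / (v x - p)) ∧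
    H y₀ = Complex.log ((v y₀ - q) / (v y₀ - p)) ∧ H y₁ = Complex.log ((v y₁ - q) / (v y₁ - p))

/-- The factor `20` makes logarithms at a far endpoint so small that sums of two of them stay
principal; `SameSide` is then symmetric and transitive. -/
theorem norm_log_div_sub_le {v p q : ℂ} {M : ℝ} (hp : ‖p‖ ≤ M) (hq : ‖q‖ ≤ M)
    (hM : 20 * M ≤ ‖v‖) (hv : 0 < ‖v‖) : ‖Complex.log ((v - q) / (v - p))‖ ≤ 1 / 4 := by
  have h1 : ‖v‖ - ‖p‖ ≤ ‖v - p‖ := norm_sub_norm_le v p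
  have h2 : 19 / 20 * ‖v‖ ≤ ‖v - p‖ := by linarith
  have h3 : 0 < ‖v - p‖ := by linarith
  have h4 : ‖(v - q) - (v - p)‖ ≤ ‖v‖ / 10 := by
    have := norm_sub_le p q
    have e : (v - q) - (v - p) = p - q := by ring
    rw [e]; linarith
  refine (norm_log_div_le (norm_pos_iff.mp h3) (by linarith)).trans ?_
  have : ‖(v - q) - (v - p)‖ / ‖v - p‖ ≤ 2 / 19 := by
    rw [div_le_iff₀ h3]; linarith
  linarith

theorem SameSide.symm {v : ℝ → ℂ} {y₀ y₁ : ℝ} {p q : ℂ} {M : ℝ} (hp : ‖p‖ ≤ M) (hq : ‖q‖ ≤ M)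
    (h0 : 20 * M ≤ ‖v y₀‖) (h1 : 20 * M ≤ ‖v y₁‖) (hv0 : 0 < ‖v y₀‖) (hv1 : 0 < ‖v y₁‖)
    (h : SameSide v y₀ y₁ p q) : SameSide v y₀ y₁ q p := by
  obtain ⟨H, hc, he, hy0, hy1⟩ := h
  have hpi := Real.pi_gt_three
  have key : ∀ y, 20 * M ≤ ‖v y‖ → 0 < ‖v y‖ →
      -Complex.log ((v y - q) / (v y - p)) = Complex.log ((v y - p) / (v y - q)) := by
    intro y hy hy'
    rw [← inv_div (v y - q) (v y - p), Complex.log_inv]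
    intro harg
    have a1 := norm_log_div_sub_le hp hq hy hy'
    have a2 := Complex.abs_im_le_norm (Complex.log ((v y - q) / (v y - p)))
    rw [Complex.log_im, harg, abs_of_pos Real.pi_pos] at a2
    linarith
  refine ⟨fun x => -H x, hc.neg, fun x hx => ?_, ?_, ?_⟩
  · rw [Complex.exp_neg, he x hx, inv_div]
  · simp only [hy0, key _ h0 hv0]
  · simp only [hy1, key _ h1 hv1]

theorem SameSide.trans {v : ℝ → ℂ} {y₀ y₁ : ℝ} (hy : y₀ ≤ y₁) {p q s : ℂ} {M : ℝ}
    (hp : ‖p‖ ≤ M) (hq : ‖q‖ ≤ M) (hs : ‖s‖ ≤ M)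
    (h0 : 20 * M ≤ ‖v y₀‖) (h1 : 20 * M ≤ ‖v y₁‖) (hv0 : 0 < ‖v y₀‖) (hv1 : 0 < ‖v y₁‖)
    (h : SameSide v y₀ y₁ p q) (h' : SameSide v y₀ y₁ q s) : SameSide v y₀ y₁ p s := by
  obtain ⟨H, hc, he, hy0, hy1⟩ := h
  obtain ⟨H', hc', he', hy0', hy1'⟩ := h'
  have hpi := Real.pi_gt_three
  have ne : ∀ x ∈ Set.Icc y₀ y₁, v x - p ≠ 0 ∧ v x - q ≠ 0 ∧ v x - s ≠ 0 := by
    intro x hx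
    have a := he x hx ▸ Complex.exp_ne_zero (H x)
    have b := he' x hx ▸ Complex.exp_ne_zero (H' x)
    rw [div_ne_zero_iff] at a b
    exact ⟨a.2, a.1, b.1⟩
  have key : ∀ y ∈ Set.Icc y₀ y₁, 20 * M ≤ ‖v y‖ → 0 < ‖v y‖ →
      Complex.log ((v y - q) / (v y - p)) + Complex.log ((v y - s) / (v y - q)) =
        Complex.log ((v y - s) / (v y - p)) := by
    intro y hy hyM hy'
    obtain ⟨n1, n2, n3⟩ := ne y hy
    have a1 := norm_log_div_sub_le hp hq hyM hy'
    have a2 := norm_log_div_sub_le hq hs hyM hy'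
    exact (log_div_trans n1 n2 n3 (by linarith)).symm
  refine ⟨fun x => H x + H' x, hc.add hc', fun x hx => ?_, ?_, ?_⟩
  · obtain ⟨n1, n2, n3⟩ := ne x hx
    rw [Complex.exp_add, he x hx, he' x hx]
    field_simp
  · simp only [hy0, hy0', key _ (Set.left_mem_Icc.mpr hy) h0 hv0]
  · simp only [hy1, hy1', key _ (Set.right_mem_Icc.mpr hy) h1 hv1]

/-- If `(v - q) / (v - p) = -t` with `t ≥ 0`, then `v` is the convex combination of `p` and `q` with
weights `t / (1 + t)` and `1 / (1 + t)`. -/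
theorem div_mem_slitPlane_of_notMem_segment {v p q : ℂ} (h : v ∉ segment ℝ p q) :
    (v - q) / (v - p) ∈ Complex.slitPlane := by
  by_contra hs
  rw [Complex.mem_slitPlane_iff_not_le_zero, not_not] at hs
  have hvp : v - p ≠ 0 := by
    intro h0
    exact h (by rw [sub_eq_zero.mp h0]; exact left_mem_segment ℝ p q)
  obtain ⟨t, ht⟩ : ∃ t : ℝ, (v - q) / (v - p) = -(t : ℂ) ∧ 0 ≤ t := by
    refine ⟨-((v - q) / (v - p)).re, ?_, ?_⟩
    · have := (Complex.le_def.mp hs).2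
      apply Complex.ext <;> simp at this ⊢
      exact this
    · have := (Complex.le_def.mp hs).1
      simp only [Complex.zero_re] at this
      linarith
  obtain ⟨ht, ht0⟩ := ht
  rw [div_eq_iff hvp] at ht
  apply h
  have h1 : (0 : ℝ) < 1 + t := by linarith
  have h1' : (1 + t : ℂ) ≠ 0 := by exact_mod_cast h1.ne'
  refine ⟨t / (1 + t), 1 / (1 + t), by positivity, by positivity, by field_simp; ring, ?_⟩
  simp only [Complex.real_smul]
  push_cast
  field_simp
  linear_combination -ht

theorem sameSide_of_segment {v : ℝ → ℂ} {y₀ y₁ : ℝ} (hv : ContinuousOn v (Set.Icc y₀ y₁))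
    {p q : ℂ} (h : ∀ x ∈ Set.Icc y₀ y₁, v x ∉ segment ℝ p q) : SameSide v y₀ y₁ p q := by
  have hs := fun x hx => div_mem_slitPlane_of_notMem_segment (h x hx)
  refine ⟨fun x => Complex.log ((v x - q) / (v x - p)), ?_, fun x hx => ?_, rfl, rfl⟩
  · refine ContinuousOn.clog (ContinuousOn.div (by fun_prop) (by fun_prop) ?_) hs
    intro x hx h0
    exact h x hx (by rw [sub_eq_zero.mp h0]; exact left_mem_segment ℝ p q)
  · exact Complex.exp_log (Complex.slitPlane_ne_zero (hs x hx))

theorem sameSide_of_near {v : ℝ → ℂ} {y₀ y₁ : ℝ} (hv : ContinuousOn v (Set.Icc y₀ y₁))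
    {p q : ℂ} {δ : ℝ} (h : ∀ x ∈ Set.Icc y₀ y₁, δ < ‖v x - p‖) (hpq : ‖q - p‖ ≤ δ) :
    SameSide v y₀ y₁ p q := by
  refine sameSide_of_segment hv fun x hx hmem => ?_
  have hball : segment ℝ p q ⊆ Metric.closedBall p δ :=
    (convex_closedBall p δ).segment_subset
      (Metric.mem_closedBall_self ((norm_nonneg _).trans hpq)) (by simpa [dist_eq_norm] using hpq)
  have := hball hmem
  rw [Metric.mem_closedBall, dist_eq_norm] at this
  linarith [h x hx]

/-- A closed polygon which is avoided by a path with far endpoints, and which winds around `p`,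
has a vertex on the same side of the path as `p`. -/
theorem exists_sameSide_of_polyIndex_ne_zero {v : ℝ → ℂ} {y₀ y₁ : ℝ} (hy : y₀ ≤ y₁)
    (hv : ContinuousOn v (Set.Icc y₀ y₁)) {Q : ℕ → ℂ} {m : ℕ} (hQ : Q m = Q 0) {p : ℂ} {r M : ℝ}
    (hr : 0 < r) (hstep : ∀ j < m, ‖Q (j + 1) - Q j‖ ≤ r / 8)
    (hvQ : ∀ x ∈ Set.Icc y₀ y₁, ∀ j ≤ m, r / 2 ≤ ‖v x - Q j‖)
    (hpQ : ∀ j ≤ m, r / 2 ≤ ‖p - Q j‖) (hp : ‖p‖ ≤ M) (hQM : ∀ j ≤ m, ‖Q j‖ + r ≤ M)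
    (h0 : 20 * M ≤ ‖v y₀‖) (h1 : 20 * M ≤ ‖v y₁‖) (hidx : polyIndex Q m p ≠ 0) :
    ∃ j ≤ m, SameSide v y₀ y₁ p (Q j) := by
  have hMpos : r ≤ M := by linarith [hQM 0 (by omega), norm_nonneg (Q 0)]
  have hstep' : ∀ j < m, ‖Q (j + 1) - Q j‖ < r / 4 := fun j hj => (hstep j hj).trans_lt (by linarith)
  -- the path has index zero
  have hvidx : ∀ x ∈ Set.Icc y₀ y₁, polyIndex Q m (v x) = 0 := by
    intro x hx
    have hS : IsPreconnected (v '' Set.Icc y₀ y₁) := isPreconnected_Icc.image _ hv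
    have e := polyIndex_eq_of_isPreconnected hQ hS hstep' (by linarith)
      (by
        rintro _ ⟨x, hx, rfl⟩ j hj
        rw [norm_sub_rev]
        linarith [hvQ x hx j hj])
      (Set.mem_image_of_mem v hx) (Set.mem_image_of_mem v (Set.left_mem_Icc.mpr hy))
    rw [e]
    apply polyIndex_eq_zero_of_far hQ
    intro j hj
    linarith [hQM j hj]
  -- Follow the segment from `p` to a point of index zero, up to the first time it is within `r / 4`
  -- of a vertex. Until then its index is constant and nonzero, so it cannot meet the path `v`,
  -- whose points have index zero. The remaining hop to the vertex is shorter than the distance from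
  -- `v` to that vertex.
  let far : ℂ := (M : ℂ)
  have hfar : ‖far‖ = M := by simp [far, abs_of_pos (hr.trans_le hMpos)]
  let g : ℝ → ℂ := fun t => p + t * (far - p)
  have hg : Continuous g := by fun_prop
  have hg0 : g 0 = p := by simp [g]
  have hg1 : g 1 = far := by simp [g]
  let T : Set ℝ := Set.Icc 0 1 ∩ ⋃ j ∈ Finset.range (m + 1), {t | ‖g t - Q j‖ ≤ r / 4}
  have hTc : IsCompact T := by
    refine isCompact_Icc.inter_right ?_
    refine Set.Finite.isClosed_biUnion (Finset.finite_toSet _) fun j _ => ?_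
    exact isClosed_le (by fun_prop) continuous_const
  have hTne : T.Nonempty := by
    by_contra hempty
    rw [Set.not_nonempty_iff_eq_empty] at hempty
    have hall : ∀ t ∈ Set.Icc (0 : ℝ) 1, ∀ j ≤ m, r / 4 ≤ ‖Q j - g t‖ := by
      intro t ht j hj
      by_contra hlt
      rw [norm_sub_rev] at hlt
      have : t ∈ T := ⟨ht, Set.mem_biUnion (Finset.mem_coe.mpr (Finset.mem_range.mpr
        (Nat.lt_succ_of_le hj))) (not_le.mp hlt).le⟩
      rw [hempty] at this
      exact this
    have hS : IsPreconnected (g '' Set.Icc 0 1) := isPreconnected_Icc.image _ hg.continuousOn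
    have e := polyIndex_eq_of_isPreconnected hQ hS hstep' (by linarith)
      (by rintro _ ⟨t, ht, rfl⟩ j hj; exact hall t ht j hj)
      (Set.mem_image_of_mem g (Set.left_mem_Icc.mpr zero_le_one))
      (Set.mem_image_of_mem g (Set.right_mem_Icc.mpr zero_le_one))
    rw [hg0, hg1] at e
    refine hidx (e.trans (polyIndex_eq_zero_of_far hQ fun j hj => ?_))
    rw [hfar]
    linarith [hQM j hj]
  obtain ⟨t, htT, htmin⟩ := hTc.exists_isLeast hTne
  obtain ⟨⟨ht0, ht1⟩, htU⟩ := htT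
  simp only [Set.mem_iUnion, Finset.mem_range, Set.mem_ofPred_eq, exists_prop] at htU
  obtain ⟨j, hj, hjt⟩ := htU
  have hj' : j ≤ m := by omega
  have hbefore : ∀ s ∈ Set.Ico 0 t, ∀ i ≤ m, r / 4 ≤ ‖Q i - g s‖ := by
    intro s hs i hi
    by_contra hlt
    rw [norm_sub_rev] at hlt
    have : s ∈ T := ⟨⟨hs.1, hs.2.le.trans ht1⟩, Set.mem_biUnion (Finset.mem_coe.mpr
      (Finset.mem_range.mpr (Nat.lt_succ_of_le hi))) (not_le.mp hlt).le⟩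
    linarith [htmin this, hs.2]
  have htpos : 0 < t := by
    rcases ht0.eq_or_lt with h | h
    · rw [← h, hg0] at hjt
      linarith [hpQ j hj']
    · exact h
  have hS : IsPreconnected (g '' Set.Ico 0 t) := isPreconnected_Ico.image _ hg.continuousOn
  have hray : ∀ s ∈ Set.Ico 0 t, polyIndex Q m (g s) ≠ 0 := by
    intro s hs
    have e := polyIndex_eq_of_isPreconnected hQ hS hstep' (by linarith)
      (by rintro _ ⟨t, ht, rfl⟩ j hj; exact hbefore t ht j hj)
      (Set.mem_image_of_mem g hs) (Set.mem_image_of_mem g (Set.left_mem_Ico.mpr htpos))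
    rw [e, hg0]
    exact hidx
  have hgt : ‖g t‖ ≤ M := by
    have := norm_le_norm_add_norm_sub' (g t) (Q j)
    linarith [hQM j hj']
  have hM0 : 0 < ‖v y₀‖ := by linarith
  have hM1 : 0 < ‖v y₁‖ := by linarith
  refine ⟨j, hj', SameSide.trans hy hp hgt (by linarith [hQM j hj']) h0 h1 hM0 hM1
    (q := g t) (sameSide_of_segment hv ?_) (SameSide.symm (M := M) (by linarith [hQM j hj']) hgt
      h0 h1 hM0 hM1 (sameSide_of_near hv (δ := r / 4) ?_ hjt))⟩
  · intro x hx hmem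
    rw [segment_eq_image_lineMap] at hmem
    obtain ⟨s, ⟨hs0, hs1⟩, hs⟩ := hmem
    have hgs : g (s * t) = v x := by
      rw [← hs, AffineMap.lineMap_apply]
      simp [g]
      ring
    rcases hs1.eq_or_lt with h | h
    · rw [h, one_mul] at hgs
      rw [hgs] at hjt
      linarith [hvQ x hx j hj']
    · refine hray (s * t) ⟨by positivity, ?_⟩ (by rw [hgs]; exact hvidx x hx)
      nlinarith
  · intro x hx
    linarith [hvQ x hx j hj']

/-! ### Mutual rotation of separated paths. -/

/-- Two discrete paths `P`, `P'` with short steps, on different sides of a path `v` whose endpoints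
are far away. -/
structure SeparatedPaths (v : ℝ → ℂ) (y₀ y₁ r M : ℝ) (P P' : ℕ → ℂ) (N : ℕ) : Prop where
  le : y₀ ≤ y₁
  cont : ContinuousOn v (Set.Icc y₀ y₁)
  pos : 0 < r
  avoid : ∀ x ∈ Set.Icc y₀ y₁, ∀ b ≤ N, 3 / 4 * r ≤ ‖v x - P b‖
  avoid' : ∀ x ∈ Set.Icc y₀ y₁, ∀ b ≤ N, 3 / 4 * r ≤ ‖v x - P' b‖
  step : ∀ b < N, ‖P (b + 1) - P b‖ ≤ r / 8
  step' : ∀ b < N, ‖P' (b + 1) - P' b‖ ≤ r / 8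
  bound : ∀ b ≤ N, ‖P b‖ + r ≤ M
  bound' : ∀ b ≤ N, ‖P' b‖ + r ≤ M
  far : 20 * M ≤ ‖v y₀‖
  far' : 20 * M ≤ ‖v y₁‖
  not_sameSide : ¬ SameSide v y₀ y₁ (P 0) (P' 0)

namespace SeparatedPaths

variable {v : ℝ → ℂ} {y₀ y₁ r M : ℝ} {P P' : ℕ → ℂ} {N : ℕ}

theorem M_pos (h : SeparatedPaths v y₀ y₁ r M P P' N) : 0 < M := by
  have := h.bound 0 (by omega)
  have := h.pos
  linarith [norm_nonneg (P 0)]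

theorem norm_pos (h : SeparatedPaths v y₀ y₁ r M P P' N) : 0 < ‖v y₀‖ ∧ 0 < ‖v y₁‖ := by
  have := h.M_pos
  exact ⟨by linarith [h.far], by linarith [h.far']⟩

theorem sameSide_symm (h : SeparatedPaths v y₀ y₁ r M P P' N) {p q : ℂ} (hp : ‖p‖ ≤ M)
    (hq : ‖q‖ ≤ M) (hpq : SameSide v y₀ y₁ p q) : SameSide v y₀ y₁ q p :=
  SameSide.symm hp hq h.far h.far' h.norm_pos.1 h.norm_pos.2 hpq

theorem sameSide_trans (h : SeparatedPaths v y₀ y₁ r M P P' N) {p q s : ℂ} (hp : ‖p‖ ≤ M)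
    (hq : ‖q‖ ≤ M) (hs : ‖s‖ ≤ M) (hpq : SameSide v y₀ y₁ p q) (hqs : SameSide v y₀ y₁ q s) :
    SameSide v y₀ y₁ p s :=
  SameSide.trans h.le hp hq hs h.far h.far' h.norm_pos.1 h.norm_pos.2 hpq hqs

theorem norm_le (h : SeparatedPaths v y₀ y₁ r M P P' N) {b : ℕ} (hb : b ≤ N) : ‖P b‖ ≤ M := by
  linarith [h.bound b hb, h.pos]

theorem norm_le' (h : SeparatedPaths v y₀ y₁ r M P P' N) {b : ℕ} (hb : b ≤ N) : ‖P' b‖ ≤ M := by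
  linarith [h.bound' b hb, h.pos]

theorem swap (h : SeparatedPaths v y₀ y₁ r M P P' N) : SeparatedPaths v y₀ y₁ r M P' P N where
  le := h.le
  cont := h.cont
  pos := h.pos
  avoid := h.avoid'
  avoid' := h.avoid
  step := h.step'
  step' := h.step
  bound := h.bound'
  bound' := h.bound
  far := h.far
  far' := h.far'
  not_sameSide hs := h.not_sameSide
    (h.sameSide_symm (h.norm_le' (by omega)) (h.norm_le (by omega)) hs)

theorem sameSide_zero (h : SeparatedPaths v y₀ y₁ r M P P' N) {b : ℕ} (hb : b ≤ N) :
    SameSide v y₀ y₁ (P 0) (P b) := by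
  have hr := h.pos
  induction b with
  | zero =>
    refine sameSide_of_near h.cont (δ := r / 8) (fun x hx => ?_) (by simp; linarith)
    linarith [h.avoid x hx 0 hb]
  | succ b ih =>
    refine h.sameSide_trans (h.norm_le (by omega)) (h.norm_le (b := b) (by omega)) (h.norm_le hb)
      (ih (by omega)) (sameSide_of_near h.cont (δ := r / 8) (fun x hx => ?_) (h.step b (by omega)))
    linarith [h.avoid x hx b (by omega)]

theorem not_sameSide_of_le (h : SeparatedPaths v y₀ y₁ r M P P' N) {b b' : ℕ} (hb : b ≤ N)
    (hb' : b' ≤ N) : ¬ SameSide v y₀ y₁ (P b) (P' b') := by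
  intro hs
  refine h.not_sameSide ?_
  have h0 := h.norm_le (b := 0) (by omega)
  have h0' := h.norm_le' (b := 0) (by omega)
  exact h.sameSide_trans h0 (h.norm_le hb) h0' (h.sameSide_zero hb)
    (h.sameSide_trans (h.norm_le hb) (h.norm_le' hb') h0' hs
      (h.sameSide_symm h0' (h.norm_le' hb') (h.swap.sameSide_zero hb')))

theorem le_dist (h : SeparatedPaths v y₀ y₁ r M P P' N) {b b' : ℕ} (hb : b ≤ N)
    (hb' : b' ≤ N) : r / 2 ≤ ‖P' b' - P b‖ := by
  have hr := h.pos
  by_contra hlt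
  refine h.not_sameSide_of_le hb hb' (sameSide_of_near h.cont (δ := r / 2) (fun x hx => ?_)
    (not_le.mp hlt).le)
  linarith [h.avoid x hx b hb]

theorem shift (h : SeparatedPaths v y₀ y₁ r M P P' N) (s n : ℕ) (hs : s + n ≤ N) :
    SeparatedPaths v y₀ y₁ r M (fun b => P (s + b)) (fun b => P' (s + b)) n where
  le := h.le
  cont := h.cont
  pos := h.pos
  avoid x hx b hb := h.avoid x hx _ (by omega)
  avoid' x hx b hb := h.avoid' x hx _ (by omega)
  step b hb := h.step (s + b) (by omega)
  step' b hb := h.step' (s + b) (by omega)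
  bound b hb := h.bound _ (by omega)
  bound' b hb := h.bound' _ (by omega)
  far := h.far
  far' := h.far'
  not_sameSide := h.not_sameSide_of_le (by omega) (by omega)

/-- Every `P' j - P i` has norm at least `r / 2`, so the diagonal of the grid can be deformed: move
`P` first with `P'` fixed at its start, then `P'` with `P` fixed at its end. -/
theorem sum_log_diag (h : SeparatedPaths v y₀ y₁ r M P P' N) :
    ∑ b ∈ Finset.range N, Complex.log ((P' (b + 1) - P (b + 1)) / (P' b - P b)) =
      polyIndex P' N (P N) + polyIndex P N (P' 0) := by
  have hr := h.pos
  have e : polyIndex P N (P' 0) =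
      ∑ i ∈ Finset.range N, Complex.log ((P' 0 - P (i + 1)) / (P' 0 - P i)) := by
    refine Finset.sum_congr rfl fun i _ => ?_
    rw [← neg_sub (P' 0), ← neg_sub (P' 0) (P i), neg_div_neg_eq]
  rw [e]
  refine sum_log_diag_eq (fun i j => P' j - P i) N ?_ ?_ ?_
  · intro i hi j hj
    have := h.le_dist hi hj
    exact norm_pos_iff.mp (by linarith)
  · intro i hi j hj
    have h1 := h.le_dist hi.le hj
    have h2 := h.step i hi
    rw [show P' j - P (i + 1) - (P' j - P i) = -(P (i + 1) - P i) by ring, norm_neg]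
    linarith
  · intro i hi j hj
    have h1 := h.le_dist hi hj.le
    have h2 := h.step' j hj
    rw [show P' (j + 1) - P i - (P' j - P i) = P' (j + 1) - P' j by ring]
    linarith

/-- If the loop `P'` wound around `P b`, one of its vertices would be on the side of `P b`. -/
theorem polyIndex_eq_zero (h : SeparatedPaths v y₀ y₁ r M P P' N) (hP' : P' N = P' 0)
    {b : ℕ} (hb : b ≤ N) : polyIndex P' N (P b) = 0 := by
  have hr := h.pos
  by_contra hidx
  obtain ⟨j, hj, hs⟩ := exists_sameSide_of_polyIndex_ne_zero h.le h.cont hP' hr h.step'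
    (fun x hx j hj => by linarith [h.avoid' x hx j hj])
    (fun j hj => by rw [norm_sub_rev]; exact h.le_dist hb hj) (h.norm_le hb) h.bound' h.far h.far'
    hidx
  exact h.not_sameSide_of_le hb hj hs

theorem sum_log_diag_eq_zero (h : SeparatedPaths v y₀ y₁ r M P P' N) (hP : P N = P 0)
    (hP' : P' N = P' 0) :
    ∑ b ∈ Finset.range N, Complex.log ((P' (b + 1) - P (b + 1)) / (P' b - P b)) = 0 := by
  rw [h.sum_log_diag, h.polyIndex_eq_zero hP' le_rfl, h.swap.polyIndex_eq_zero hP (by omega),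
    add_zero]

/-- An almost closed pair becomes a pair of loops by one further step back to the start. -/
theorem close (h : SeparatedPaths v y₀ y₁ r M P P' N) (hP : ‖P N - P 0‖ ≤ r / 8)
    (hP' : ‖P' N - P' 0‖ ≤ r / 8) :
    SeparatedPaths v y₀ y₁ r M (fun b => if b ≤ N then P b else P 0)
      (fun b => if b ≤ N then P' b else P' 0) (N + 1) where
  le := h.le
  cont := h.cont
  pos := h.pos
  avoid x hx b hb := by
    split_ifs with hbN
    exacts [h.avoid x hx b hbN, h.avoid x hx 0 (by omega)]
  avoid' x hx b hb := by
    split_ifs with hbN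
    exacts [h.avoid' x hx b hbN, h.avoid' x hx 0 (by omega)]
  step b hb := by
    rcases Nat.lt_succ_iff_lt_or_eq.mp hb with hb | rfl
    · simpa [hb.le, Nat.succ_le_of_lt hb] using h.step b hb
    · simpa [norm_sub_rev] using hP
  step' b hb := by
    rcases Nat.lt_succ_iff_lt_or_eq.mp hb with hb | rfl
    · simpa [hb.le, Nat.succ_le_of_lt hb] using h.step' b hb
    · simpa [norm_sub_rev] using hP'
  bound b hb := by
    split_ifs with hbN
    exacts [h.bound b hbN, h.bound 0 (by omega)]
  bound' b hb := by
    split_ifs with hbN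
    exacts [h.bound' b hbN, h.bound' 0 (by omega)]
  far := h.far
  far' := h.far'
  not_sameSide := by simpa using h.not_sameSide

/-- The closed-up pair has total rotation zero, so only the logarithm of the closing step is left.
-/
theorem norm_sum_log_diag_le_of_return (h : SeparatedPaths v y₀ y₁ r M P P' N)
    (hP : ‖P N - P 0‖ ≤ r / 8) (hP' : ‖P' N - P' 0‖ ≤ r / 8) :
    ‖∑ b ∈ Finset.range N, Complex.log ((P' (b + 1) - P (b + 1)) / (P' b - P b))‖ ≤ 3 / 4 := by
  have hr := h.pos
  have hz := (h.close hP hP').sum_log_diag_eq_zero (by simp) (by simp)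
  have hd := h.le_dist (b := N) (b' := N) le_rfl le_rfl
  have hd0 : P' N - P N ≠ 0 := norm_pos_iff.mp (by linarith)
  rw [Finset.sum_range_succ] at hz
  have e : ∑ b ∈ Finset.range N, Complex.log
      (((if b + 1 ≤ N then P' (b + 1) else P' 0) - (if b + 1 ≤ N then P (b + 1) else P 0)) /
        ((if b ≤ N then P' b else P' 0) - (if b ≤ N then P b else P 0))) =
      ∑ b ∈ Finset.range N, Complex.log ((P' (b + 1) - P (b + 1)) / (P' b - P b)) := by
    refine Finset.sum_congr rfl fun b hb => ?_
    have hb' := Finset.mem_range.mp hb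
    rw [if_pos (Nat.succ_le_of_lt hb'), if_pos (Nat.succ_le_of_lt hb'), if_pos hb'.le,
      if_pos hb'.le]
  rw [e] at hz
  simp only [le_refl, if_true, show ¬ N + 1 ≤ N by omega, if_false] at hz
  rw [eq_neg_of_add_eq_zero_left hz, norm_neg]
  have hdiff : ‖P' 0 - P 0 - (P' N - P N)‖ ≤ ‖P' N - P N‖ / 2 := by
    rw [show P' 0 - P 0 - (P' N - P N) = (P N - P 0) - (P' N - P' 0) by ring]
    linarith [norm_sub_le (P N - P 0) (P' N - P' 0)]
  refine (norm_log_div_le hd0 hdiff).trans ?_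
  have : ‖P' 0 - P 0 - (P' N - P N)‖ / ‖P' N - P N‖ ≤ 1 / 2 := by
    rw [div_le_iff₀ (by linarith)]; linarith
  linarith

/-- A step seen from distance at most `ρ` costs at most `1`, plus the uniform error; one seen from
farther away costs at most `3/2 * (r/8) / ρ`. -/
theorem norm_polyIndex_le (h : SeparatedPaths v y₀ y₁ r M P P' N) {b : ℕ} (hb : b ≤ N)
    {ρ : ℝ} (hρ : 0 < ρ) {C : ℕ}
    (hC : ((Finset.range (N + 1)).filter fun b' => ‖P' b' - P b‖ ≤ ρ).card ≤ C) :
    ‖polyIndex P' N (P b)‖ ≤ C + N * (3 / 16 * r / ρ) := by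
  have hr := h.pos
  have hterm : ∀ j ∈ Finset.range N, ‖Complex.log ((P' (j + 1) - P b) / (P' j - P b))‖ ≤
      (if ‖P' j - P b‖ ≤ ρ then 1 else 0) + 3 / 16 * r / ρ := by
    intro j hj
    have hj' := Finset.mem_range.mp hj
    have h1 := h.le_dist hb hj'.le
    have h2 := h.step' j hj'
    have h0 : P' j - P b ≠ 0 := norm_pos_iff.mp (by linarith)
    have h3 : ‖P' (j + 1) - P b - (P' j - P b)‖ ≤ r / 8 := by simpa using h2
    have hnn : 0 ≤ 3 / 16 * r / ρ := by positivity
    split_ifs with hle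
    · have h5 := norm_log_div_le_of_quarter h0 (h3.trans (by linarith))
      linarith
    · have hlt := not_le.mp hle
      refine (norm_log_div_le h0 (by linarith)).trans ?_
      have h4 : ‖P' (j + 1) - P b - (P' j - P b)‖ / ‖P' j - P b‖ ≤ r / 8 / ρ := by gcongr
      calc _ ≤ 3 / 2 * (r / 8 / ρ) := by gcongr
        _ = 0 + 3 / 16 * r / ρ := by ring
  refine (norm_sum_le _ _).trans ((Finset.sum_le_sum hterm).trans ?_)
  rw [Finset.sum_add_distrib, Finset.sum_const, Finset.card_range, nsmul_eq_mul, Finset.sum_boole]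
  gcongr
  refine le_trans (Finset.card_le_card ?_) hC
  exact Finset.filter_subset_filter _ (Finset.range_mono (by omega))

end SeparatedPaths

/-! ### The length bound. -/

/-- Pigeonhole on the pairs `(P b - q, P' b - P b)`, which lie in a compact set independent of the
paths and of `q`: indices in the same small ball are simultaneous returns, so each ball holds at
most `T` of them. -/
theorem exists_card_le_of_no_return (r R ρ : ℝ) (hr : 0 < r) (T : ℕ) :
    ∃ C : ℕ, ∀ (N : ℕ) (P P' : ℕ → ℂ), (∀ b ≤ N, ‖P' b - P b‖ ≤ R) →
      (∀ s t, s + T ≤ t → t ≤ N → ¬ (‖P t - P s‖ ≤ r / 8 ∧ ‖P' t - P' s‖ ≤ r / 8)) →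
      ∀ q, ((Finset.range (N + 1)).filter fun b => ‖P b - q‖ ≤ ρ).card ≤ C := by
  have hK : IsCompact (Metric.closedBall (0 : ℂ) ρ ×ˢ Metric.closedBall (0 : ℂ) R) :=
    (isCompact_closedBall _ _).prod (isCompact_closedBall _ _)
  obtain ⟨t, -, htf, hcov⟩ := hK.finite_cover_balls (e := r / 32) (by positivity)
  refine ⟨htf.toFinset.card * T, fun N P P' hR hno q => ?_⟩
  by_contra hlt
  have hmem : ∀ b ∈ (Finset.range (N + 1)).filter (fun b => ‖P b - q‖ ≤ ρ), ∃ c ∈ htf.toFinset,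
      ((P b - q, P' b - P b) : ℂ × ℂ) ∈ Metric.ball c (r / 32) := by
    intro b hb
    rw [Finset.mem_filter, Finset.mem_range] at hb
    have hin : ((P b - q, P' b - P b) : ℂ × ℂ) ∈
        Metric.closedBall (0 : ℂ) ρ ×ˢ Metric.closedBall (0 : ℂ) R := by
      simp only [Set.mem_prod, mem_closedBall_zero_iff]
      exact ⟨hb.2, hR b (by omega)⟩
    simpa using hcov hin
  choose! F hF hFb using hmem
  obtain ⟨c, -, hc⟩ := Finset.exists_lt_card_fiber_of_mul_lt_card_of_maps_to hF (not_le.mp hlt)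
  set S := ((Finset.range (N + 1)).filter fun b => ‖P b - q‖ ≤ ρ).filter fun x => F x = c with hS
  have hSne : S.Nonempty := Finset.card_pos.mp (by omega)
  have hsub : S ⊆ Finset.Ico (S.min' hSne) (S.min' hSne + T) := by
    intro b hb
    rw [Finset.mem_Ico]
    refine ⟨S.min'_le b hb, ?_⟩
    by_contra hge
    have hm := S.min'_mem hSne
    have hb1 := Finset.mem_filter.mp hb
    have hm1 := Finset.mem_filter.mp hm
    have hbN : b ≤ N := by
      have := Finset.mem_range.mp (Finset.mem_filter.mp hb1.1).1
      omega
    refine hno _ b (not_lt.mp hge) hbN ?_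
    have d1 := hFb b hb1.1
    have d2 := hFb _ hm1.1
    rw [hb1.2] at d1
    rw [hm1.2] at d2
    have d3 : dist ((P b - q, P' b - P b) : ℂ × ℂ)
        (P (S.min' hSne) - q, P' (S.min' hSne) - P (S.min' hSne)) < r / 16 := by
      have := dist_triangle_right ((P b - q, P' b - P b) : ℂ × ℂ)
        (P (S.min' hSne) - q, P' (S.min' hSne) - P (S.min' hSne)) c
      rw [Metric.mem_ball] at d1 d2
      linarith
    rw [Prod.dist_eq, max_lt_iff, dist_eq_norm, dist_eq_norm] at d3
    have e1 := d3.1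
    have e2 := d3.2
    rw [show P b - q - (P (S.min' hSne) - q) = P b - P (S.min' hSne) by ring] at e1
    refine ⟨by linarith, ?_⟩
    have := norm_add_le (P' b - P b - (P' (S.min' hSne) - P (S.min' hSne)))
      (P b - P (S.min' hSne))
    rw [show P' b - P b - (P' (S.min' hSne) - P (S.min' hSne)) + (P b - P (S.min' hSne)) =
      P' b - P' (S.min' hSne) by ring] at this
    linarith
  have := Finset.card_le_card hsub
  rw [Nat.card_Ico] at this
  omega

/-- Two separated paths which rotate about each other at a nonzero mean rate are short. -/
theorem exists_length_bound (r R G : ℝ) (hr : 0 < r) (X : ℂ) (hX : X ≠ 0) :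
    ∃ K : ℕ, ∀ (v : ℝ → ℂ) (y₀ y₁ M : ℝ) (P P' : ℕ → ℂ) (N : ℕ),
      SeparatedPaths v y₀ y₁ r M P P' N → (∀ b ≤ N, ‖P' b - P b‖ ≤ R) →
      (∀ s n, s + n ≤ N → ‖∑ b ∈ Finset.range n,
        Complex.log ((P' (s + b + 1) - P (s + b + 1)) / (P' (s + b) - P (s + b))) - n * X‖ ≤ G) →
      N < K := by
  have hX' : 0 < ‖X‖ := norm_pos_iff.mpr hX
  obtain ⟨T, hT⟩ := exists_nat_gt ((G + 1) / ‖X‖)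
  rw [div_lt_iff₀ hX'] at hT
  -- With this radius the far steps of both indices contribute at most `2 * (3/32) * N * ‖X‖`, a
  -- small part of the total rotation, which is at least `N * ‖X‖ - G`.
  set ρ := 2 * r / ‖X‖ with hρdef
  have hρ : 0 < ρ := by positivity
  obtain ⟨C, hC⟩ := exists_card_le_of_no_return r R ρ hr T
  obtain ⟨K, hK⟩ := exists_nat_gt ((2 * C + G) * 2 / ‖X‖)
  refine ⟨K, fun v y₀ y₁ M P P' N h hR hrot => ?_⟩
  have hlower : ∀ s n, s + n ≤ N → n * ‖X‖ - G ≤ ‖∑ b ∈ Finset.range n,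
      Complex.log ((P' (s + b + 1) - P (s + b + 1)) / (P' (s + b) - P (s + b)))‖ := by
    intro s n hsn
    have h1 := hrot s n hsn
    have h2 := norm_sub_norm_le ((n : ℂ) * X) (∑ b ∈ Finset.range n,
      Complex.log ((P' (s + b + 1) - P (s + b + 1)) / (P' (s + b) - P (s + b))))
    rw [norm_sub_rev, norm_mul, Complex.norm_natCast] at h2
    linarith
  have hno : ∀ s t, s + T ≤ t → t ≤ N →
      ¬ (‖P t - P s‖ ≤ r / 8 ∧ ‖P' t - P' s‖ ≤ r / 8) := by
    rintro s t hst htN ⟨h1, h2⟩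
    obtain ⟨n, rfl⟩ := Nat.exists_eq_add_of_le (show s ≤ t by omega)
    have h3 := (h.shift s n htN).norm_sum_log_diag_le_of_return (by simpa using h1)
      (by simpa using h2)
    have h4 := hlower s n htN
    simp only [← add_assoc] at h3
    have h5 : (T : ℝ) ≤ n := by exact_mod_cast (by omega : T ≤ n)
    nlinarith
  have hno' : ∀ s t, s + T ≤ t → t ≤ N →
      ¬ (‖P' t - P' s‖ ≤ r / 8 ∧ ‖P t - P s‖ ≤ r / 8) :=
    fun s t hst htN hh => hno s t hst htN hh.symm
  have c1 := hC N P P' hR hno (P' 0)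
  have c2 := hC N P' P (fun b hb => by rw [norm_sub_rev]; exact hR b hb) hno' (P N)
  have b1 := h.norm_polyIndex_le le_rfl hρ c2
  have b2 := h.swap.norm_polyIndex_le (b := 0) (by omega) hρ c1
  have l := hlower 0 N (by omega)
  simp only [zero_add] at l
  rw [h.sum_log_diag] at l
  have l2 := l.trans (norm_add_le _ _)
  have hq : 3 / 16 * r / ρ = 3 / 32 * ‖X‖ := by
    rw [hρdef]; field_simp; norm_num
  rw [hq] at b1 b2
  have hN : (N : ℝ) * ‖X‖ ≤ (2 * C + G) * 2 := by
    have : 0 ≤ (N : ℝ) * ‖X‖ := by positivity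
    nlinarith
  have : (N : ℝ) < K := lt_of_le_of_lt (by rw [le_div_iff₀ hX']; exact hN) hK
  exact_mod_cast this

/-! ### Twisted sums and return times. -/

/-- Twisted Birkhoff sums over the rotation by `a`. -/
noncomputable def twistedSum (E : ℂ) (a : UnitAddCircle) (f : UnitAddCircle → ℂ) (n : ℕ)
    (x : UnitAddCircle) : ℂ :=
  ∑ j ∈ Finset.range n, E ^ j * f (x + j • a)

theorem twistedSum_add (E : ℂ) (a : UnitAddCircle) (f : UnitAddCircle → ℂ) (m n : ℕ)
    (x : UnitAddCircle) :
    twistedSum E a f (m + n) x = twistedSum E a f m x + E ^ m * twistedSum E a f n (x + m • a) := by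
  simp only [twistedSum, Finset.sum_range_add, Finset.mul_sum, pow_add, add_smul, mul_assoc,
    add_assoc]

/-- Splitting the sum of length `b + n` in both orders shows that moving the base point by `b` steps
changes the `n`-th sum by a defect that is small at return times `n`. -/
theorem twistedSum_shift (E : ℂ) (a : UnitAddCircle) (f : UnitAddCircle → ℂ) (b n : ℕ)
    (x : UnitAddCircle) :
    E ^ b * twistedSum E a f n (x + b • a) =
      twistedSum E a f n x + (E ^ n * twistedSum E a f b (x + n • a) - twistedSum E a f b x) := by
  have h1 := twistedSum_add E a f b n x
  have h2 := twistedSum_add E a f n b x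
  rw [add_comm n b] at h2
  linear_combination h2 - h1

theorem continuous_twistedSum (E : ℂ) (a : UnitAddCircle) {f : UnitAddCircle → ℂ}
    (hf : Continuous f) (n : ℕ) : Continuous (twistedSum E a f n) := by
  unfold twistedSum
  fun_prop

theorem norm_twistedSum_sub_le {E : ℂ} (hE : ‖E‖ = 1) (a : UnitAddCircle) (f : UnitAddCircle → ℂ)
    {n : ℕ} {η : ℝ} (h : ∀ x, ‖E ^ n * f (x + n • a) - f x‖ ≤ η) (b : ℕ) (x : UnitAddCircle) :
    ‖(E ^ n * twistedSum E a f (b + 1) (x + n • a) - twistedSum E a f (b + 1) x) -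
      (E ^ n * twistedSum E a f b (x + n • a) - twistedSum E a f b x)‖ ≤ η := by
  have e : (E ^ n * twistedSum E a f (b + 1) (x + n • a) - twistedSum E a f (b + 1) x) -
      (E ^ n * twistedSum E a f b (x + n • a) - twistedSum E a f b x) =
      E ^ b * (E ^ n * f (x + b • a + n • a) - f (x + b • a)) := by
    simp only [twistedSum, Finset.sum_range_succ]
    rw [add_right_comm x (n • a)]
    ring
  rw [e, norm_mul, norm_pow, hE, one_pow, one_mul]
  exact h _

theorem norm_twistedSum_sub_le_mul {E : ℂ} (hE : ‖E‖ = 1) (a : UnitAddCircle)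
    (f : UnitAddCircle → ℂ) {n : ℕ} {η : ℝ} (h : ∀ x, ‖E ^ n * f (x + n • a) - f x‖ ≤ η) (b : ℕ)
    (x : UnitAddCircle) :
    ‖E ^ n * twistedSum E a f b (x + n • a) - twistedSum E a f b x‖ ≤ b * η := by
  induction b with
  | zero => simp [twistedSum]
  | succ b ih =>
    have h1 := norm_twistedSum_sub_le hE a f h b x
    have h2 := norm_le_norm_add_norm_sub' (E ^ n * twistedSum E a f (b + 1) (x + n • a) -
      twistedSum E a f (b + 1) x) (E ^ n * twistedSum E a f b (x + n • a) - twistedSum E a f b x)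
    push_cast
    linarith

/-- `n` is an `ε`-return time of the rotation by `a` and of the multiplication by `E`. -/
def IsReturn (E : ℂ) (a : UnitAddCircle) (ε : ℝ) (n : ℕ) : Prop :=
  ‖n • a‖ < ε ∧ ‖E ^ n - 1‖ < ε

theorem IsReturn.mono {E : ℂ} {a : UnitAddCircle} {ε ε' : ℝ} {n : ℕ} (h : IsReturn E a ε n)
    (hε : ε ≤ ε') : IsReturn E a ε' n :=
  ⟨h.1.trans_le hε, h.2.trans_le hε⟩

theorem isReturn_sub_of_dist {E : ℂ} (hE : ‖E‖ = 1) {a : UnitAddCircle} {ε : ℝ} {m n : ℕ}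
    (hmn : m ≤ n) (h1 : ‖n • a - m • a‖ < ε) (h2 : ‖E ^ n - E ^ m‖ < ε) :
    IsReturn E a ε (n - m) := by
  obtain ⟨k, rfl⟩ := Nat.exists_eq_add_of_le hmn
  rw [Nat.add_sub_cancel_left]
  refine ⟨by simpa [add_smul] using h1, ?_⟩
  rw [pow_add, show E ^ m * E ^ k - E ^ m = E ^ m * (E ^ k - 1) by ring, norm_mul, norm_pow, hE,
    one_pow, one_mul] at h2
  exact h2

theorem IsReturn.sub {E : ℂ} (hE : ‖E‖ = 1) {a : UnitAddCircle} {ε : ℝ} {m n : ℕ}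
    (hm : IsReturn E a (ε / 2) m) (hn : IsReturn E a (ε / 2) n) (hmn : m ≤ n) :
    IsReturn E a ε (n - m) := by
  refine isReturn_sub_of_dist hE hmn ?_ ?_
  · have := norm_sub_le (n • a) (m • a)
    linarith [hm.1, hn.1]
  · have := norm_sub_le (E ^ n - 1) (E ^ m - 1)
    rw [sub_sub_sub_cancel_right] at this
    linarith [hm.2, hn.2]

/-- Return times have bounded gaps, since the orbit `(n • a, E ^ n)` is totally bounded and finitely
many of its points approximate all the others. -/
theorem exists_isReturn_sub {E : ℂ} (hE : ‖E‖ = 1) (a : UnitAddCircle) {ε : ℝ} (hε : 0 < ε) :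
    ∃ K : ℕ, ∀ n, ∃ j ≤ K, j ≤ n ∧ IsReturn E a ε (n - j) := by
  let F : ℕ → UnitAddCircle × ℂ := fun n => (n • a, E ^ n)
  have hcpt : IsCompact ((Set.univ : Set UnitAddCircle) ×ˢ Metric.closedBall (0 : ℂ) 1) :=
    isCompact_univ.prod (isCompact_closedBall _ _)
  have hsub : Set.range F ⊆ (Set.univ : Set UnitAddCircle) ×ˢ Metric.closedBall (0 : ℂ) 1 := by
    rintro _ ⟨n, rfl⟩
    simp [F, hE]
  have htb : TotallyBounded (Set.range F) := hcpt.totallyBounded.subset hsub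
  obtain ⟨t, hts, htf, hcov⟩ := Metric.finite_approx_of_totallyBounded htb ε hε
  have hts' : ∀ y ∈ t, ∃ k, F k = y := fun y hy => hts hy
  choose! k hk using hts'
  refine ⟨htf.toFinset.sup k, fun n => ?_⟩
  obtain ⟨y, hy, hny⟩ : ∃ y ∈ t, F n ∈ Metric.ball y ε := by
    simpa using hcov (Set.mem_range_self n)
  have hkK : k y ≤ htf.toFinset.sup k := Finset.le_sup (htf.mem_toFinset.mpr hy)
  rcases le_total (k y) n with hle | hle
  · refine ⟨k y, hkK, hle, ?_⟩
    rw [← hk y hy, Metric.mem_ball, Prod.dist_eq, max_lt_iff, dist_eq_norm, dist_eq_norm] at hny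
    exact isReturn_sub_of_dist hE hle hny.1 hny.2
  -- For small `n` the return time used is `0`.
  · exact ⟨n, hle.trans hkK, le_rfl, by simpa [IsReturn] using hε⟩

theorem exists_isReturn_ge {E : ℂ} (hE : ‖E‖ = 1) (a : UnitAddCircle) {ε : ℝ} (hε : 0 < ε)
    (N : ℕ) : ∃ n ≥ N, IsReturn E a ε n := by
  obtain ⟨K, hK⟩ := exists_isReturn_sub hE a hε
  obtain ⟨j, hj, -, h⟩ := hK (N + K)
  exact ⟨N + K - j, by omega, h⟩

theorem exists_bound_of_continuous {h : UnitAddCircle → ℂ} (hh : Continuous h) :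
    ∃ B, 0 < B ∧ ∀ x, ‖h x‖ ≤ B := by
  obtain ⟨B, hB⟩ := isCompact_univ.exists_bound_of_continuousOn hh.continuousOn
  exact ⟨max B 1, by positivity, fun x => (hB x trivial).trans (le_max_left _ _)⟩

theorem exists_unif_cont {h : UnitAddCircle → ℂ} (hh : Continuous h) {η : ℝ} (hη : 0 < η) :
    ∃ δ > 0, ∀ x y : UnitAddCircle, ‖x - y‖ < δ → ‖h x - h y‖ < η := by
  obtain ⟨δ, hδ, H⟩ := Metric.uniformContinuous_iff.mp
    (CompactSpace.uniformContinuous_of_continuous hh) η hη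
  exact ⟨δ, hδ, fun x y hxy => by
    rw [← dist_eq_norm] at hxy ⊢
    exact H hxy⟩

theorem exists_isReturn_norm_sub_le {E : ℂ} (a : UnitAddCircle)
    {h : UnitAddCircle → ℂ} (hh : Continuous h) {η : ℝ} (hη : 0 < η) :
    ∃ ε > 0, ∀ n, IsReturn E a ε n → ∀ x, ‖E ^ n * h (x + n • a) - h x‖ ≤ η := by
  obtain ⟨B, hB0, hB⟩ := exists_bound_of_continuous hh
  obtain ⟨δ, hδ, H⟩ := exists_unif_cont hh (half_pos hη)
  refine ⟨min δ (η / 2 / B), by positivity, fun n hn x => ?_⟩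
  have h1 := H (x + n • a) x (by simpa using hn.1.trans_le (min_le_left _ _))
  have h2 : ‖(E ^ n - 1) * h (x + n • a)‖ ≤ η / 2 := by
    rw [norm_mul]
    calc _ ≤ (η / 2 / B) * B := by
          gcongr
          · exact (hn.2.trans_le (min_le_right _ _)).le
          · exact hB _
      _ = η / 2 := by field_simp
  rw [show E ^ n * h (x + n • a) - h x = (E ^ n - 1) * h (x + n • a) + (h (x + n • a) - h x) by
    ring]
  linarith [norm_add_le ((E ^ n - 1) * h (x + n • a)) (h (x + n • a) - h x)]

/-! ### Winding numbers of functions on the circle. -/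

/-- The function `h` on the circle has a continuous logarithm along `ℝ` with increment `2πid`
over a period. -/
def HasWinding (h : UnitAddCircle → ℂ) (d : ℤ) : Prop :=
  ∃ L : ℝ → ℂ, Continuous L ∧ (∀ t : ℝ, Complex.exp (L t) = h t) ∧
    ∀ t, L (t + 1) = L t + d * (2 * Real.pi * Complex.I)

theorem coe_add_one (t : ℝ) : ((t + 1 : ℝ) : UnitAddCircle) = t := by
  rw [AddCircle.coe_add, AddCircle.coe_period, add_zero]

theorem eq_const_of_exp_eq_one {D : ℝ → ℂ} (hD : Continuous D)
    (h : ∀ t, Complex.exp (D t) = 1) : ∃ k : ℤ, ∀ t, D t = k * (2 * Real.pi * Complex.I) := by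
  obtain ⟨k, hk⟩ := Complex.exp_eq_one_iff.mp (h 0)
  refine ⟨k, fun t => ?_⟩
  rw [← hk]
  exact eq_of_exp_eq_one isPreconnected_univ hD.continuousOn (fun x _ => h x) trivial trivial

theorem exists_hasWinding {h : UnitAddCircle → ℂ} (hh : Continuous h) (h0 : ∀ x, h x ≠ 0) :
    ∃ d, HasWinding h d := by
  have hc : Continuous fun t : ℝ => h t := hh.comp (AddCircle.continuous_mk' 1)
  have hsc : IsSimplyConnected (Set.univ : Set ℝ) := by
    have := (convex_univ (𝕜 := ℝ) (E := ℝ)).contractibleSpace Set.univ_nonempty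
    exact (inferInstance : SimplyConnectedSpace (Set.univ : Set ℝ))
  obtain ⟨L, hL, hLe⟩ := Complex.exists_continuousOn_eqOn_exp_comp hsc isOpen_univ
    hc.continuousOn (by rintro ⟨t, -, ht⟩; exact h0 _ ht)
  rw [continuousOn_univ] at hL
  have hLe' : ∀ t, Complex.exp (L t) = h t := fun t => hLe (Set.mem_univ t)
  obtain ⟨d, hd⟩ := eq_const_of_exp_eq_one (D := fun t => L (t + 1) - L t) (by fun_prop)
    (fun t => by rw [Complex.exp_sub, hLe', hLe', coe_add_one, div_self (h0 _)])
  exact ⟨d, L, hL, hLe', fun t => by rw [← hd t]; ring⟩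

theorem HasWinding.ne_zero {h : UnitAddCircle → ℂ} {d : ℤ} (hd : HasWinding h d)
    (x : UnitAddCircle) : h x ≠ 0 := by
  obtain ⟨L, -, hL, -⟩ := hd
  obtain ⟨t, rfl⟩ := QuotientAddGroup.mk_surjective x
  exact hL t ▸ Complex.exp_ne_zero _

theorem exists_bound_of_periodic {g : ℝ → ℂ} (hg : Continuous g) (hp : Function.Periodic g 1) :
    ∃ B, ∀ t, ‖g t‖ ≤ B := by
  obtain ⟨B, hB⟩ := isCompact_Icc.exists_bound_of_continuousOn (s := Set.Icc (0 : ℝ) 1)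
    hg.continuousOn
  refine ⟨B, fun t => ?_⟩
  obtain ⟨s, hs, e⟩ := hp.exists_mem_Ico₀ one_pos t
  rw [e]
  exact hB s ⟨hs.1, hs.2.le⟩

/-- A nowhere vanishing function which is almost equivariant under the rotation turns at the mean
rate `2π(dα - β)` modulo `2π`, where `d` is its winding number. -/
theorem HasWinding.exists_rotation {α β : ℝ} {h : UnitAddCircle → ℂ} (hh : Continuous h) {d : ℤ}
    (hd : HasWinding h d)
    (hstep : ∀ x, ‖Complex.exp (-(2 * Real.pi * Complex.I * β)) * h (x + (α : UnitAddCircle)) -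
      h x‖ ≤ ‖h x‖ / 4) :
    ∃ k : ℤ, ∃ G : ℝ, ∀ (n : ℕ) (x : UnitAddCircle), ‖∑ b ∈ Finset.range n, Complex.log
      (Complex.exp (-(2 * Real.pi * Complex.I * β)) * h (x + (b + 1) • (α : UnitAddCircle)) /
        h (x + b • (α : UnitAddCircle))) - n * (2 * Real.pi * Complex.I * (d * α - β - k))‖ ≤ G := by
  have h0 := hd.ne_zero
  obtain ⟨L, hLc, hLe, hLp⟩ := hd
  set E := Complex.exp (-(2 * Real.pi * Complex.I * β)) with hEdef
  have hE0 : E ≠ 0 := Complex.exp_ne_zero _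
  have hc : Continuous fun t : ℝ => h t := hh.comp (AddCircle.continuous_mk' 1)
  have hlogc : Continuous fun t : ℝ => Complex.log (E * h ((t + α : ℝ) : UnitAddCircle) / h t) := by
    refine Continuous.clog ?_ fun t => ?_
    · exact (continuous_const.mul (hc.comp (continuous_id.add continuous_const))).div hc
        fun t => h0 _
    · apply mem_slitPlane_div
      have := hstep t
      rw [← AddCircle.coe_add] at this
      linarith [norm_pos_iff.mpr (h0 t)]
  obtain ⟨k, hk⟩ := eq_const_of_exp_eq_one (D := fun t => L (t + α) - L t -
      2 * Real.pi * Complex.I * β - Complex.log (E * h ((t + α : ℝ) : UnitAddCircle) / h t))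
    (by fun_prop) (fun t => by
      rw [Complex.exp_sub, Complex.exp_log (div_ne_zero (mul_ne_zero hE0 (h0 _)) (h0 _)),
        Complex.exp_sub, Complex.exp_sub, hLe, hLe, hEdef, Complex.exp_neg]
      have h1 := h0 t
      have h2 := h0 ((t + α : ℝ) : UnitAddCircle)
      have h3 := Complex.exp_ne_zero (2 * Real.pi * Complex.I * β)
      field_simp)
  -- Removing the linear part of the lift leaves a periodic, hence bounded, function. The sum of
  -- logarithms telescopes to its increment plus `n` times the mean rate.
  let g : ℝ → ℂ := fun t => L t - 2 * Real.pi * Complex.I * d * t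
  have hgp : Function.Periodic g 1 := fun t => by
    simp only [g, hLp]
    push_cast
    ring
  obtain ⟨B, hB⟩ := exists_bound_of_periodic (g := g) (by fun_prop) hgp
  refine ⟨k, B + B, fun n x => ?_⟩
  obtain ⟨t, rfl⟩ := QuotientAddGroup.mk_surjective x
  have hsum : ∑ b ∈ Finset.range n, Complex.log (E * h ((t : UnitAddCircle) +
      (b + 1) • (α : UnitAddCircle)) / h ((t : UnitAddCircle) + b • (α : UnitAddCircle))) =
      g (t + n * α) - g t + n * (2 * Real.pi * Complex.I * (d * α - β - k)) := by
    induction n with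
    | zero => simp
    | succ n ih =>
      rw [Finset.sum_range_succ, ih]
      have e1 : (t : UnitAddCircle) + n • (α : UnitAddCircle) = ((t + n * α : ℝ) : UnitAddCircle) := by
        rw [AddCircle.coe_add, ← nsmul_eq_mul, AddCircle.coe_nsmul]
      have e2 : (t : UnitAddCircle) + (n + 1) • (α : UnitAddCircle) =
          ((t + n * α + α : ℝ) : UnitAddCircle) := by
        rw [AddCircle.coe_add, ← e1, add_smul, one_smul, add_assoc]
      have hkn := hk (t + n * α)
      rw [e1, e2]
      have e3 : t + ((n + 1 : ℕ) : ℝ) * α = t + n * α + α := by push_cast; ring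
      rw [e3]
      simp only [g]
      push_cast
      linear_combination -hkn
  change ‖∑ b ∈ Finset.range n, Complex.log (E * h ((t : UnitAddCircle) +
      (b + 1) • (α : UnitAddCircle)) / h ((t : UnitAddCircle) + b • (α : UnitAddCircle))) - _‖ ≤ _
  rw [hsum, add_sub_cancel_right]
  exact (norm_sub_le _ _).trans (add_le_add (hB _) (hB _))

theorem norm_le_of_forall_mul_le {c η G : ℝ} (h : ∀ n : ℕ, n * c ≤ n * η + G) : c ≤ η := by
  by_contra hlt
  have hpos : 0 < c - η := by linarith
  obtain ⟨n, hn⟩ := exists_nat_gt (G / (c - η))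
  rw [div_lt_iff₀ hpos] at hn
  have := h n
  nlinarith

theorem norm_coe_le_abs (t : ℝ) : ‖(t : UnitAddCircle)‖ ≤ |t| := by
  rw [UnitAddCircle.norm_eq]
  simpa using round_le t 0

theorem HasWinding.eq_of_sameSide {A B : UnitAddCircle → ℂ} (hA : Continuous A) (hB : Continuous B)
    {d d' : ℤ} (hd : HasWinding A d) (hd' : HasWinding (fun x => A x + B x) d') {J : ℕ}
    (hJ : 0 < J) {r M : ℝ} (hM : 0 < M) (hr : ∀ x, r ≤ ‖A x + B x‖) (hBM : ∀ x, ‖B x‖ ≤ M)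
    (hfar : ∀ j ≤ J, 20 * M ≤ ‖A ((j / J : ℝ) : UnitAddCircle)‖)
    (hosc : ∀ j < J, ∀ x ∈ Set.Icc (j / J : ℝ) ((j + 1 : ℕ) / J : ℝ),
      ‖B (x : UnitAddCircle) - B ((j / J : ℝ) : UnitAddCircle)‖ ≤ r / 5)
    (hside : ∀ j < J, SameSide (fun t => A (t : UnitAddCircle)) (j / J) ((j + 1 : ℕ) / J) 0
      (-B ((j / J : ℝ) : UnitAddCircle))) : d = d' := by
  have hA0 := hd.ne_zero
  have hC0 := hd'.ne_zero
  obtain ⟨L, hLc, hLe, hLp⟩ := hd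
  obtain ⟨L', hLc', hLe', hLp'⟩ := hd'
  have hpi := Real.pi_gt_three
  have hJ' : (0 : ℝ) < J := by exact_mod_cast hJ
  have hAc : Continuous fun t : ℝ => A t := hA.comp (AddCircle.continuous_mk' 1)
  have hBc : Continuous fun t : ℝ => B t := hB.comp (AddCircle.continuous_mk' 1)
  -- Compares the two lifts at the node `j / J`. On an arc, `(A + B) / A` factors through `A + B₀`:
  -- the logarithm of `(A + B₀) / A` given by `SameSide` is principal at both ends, and `(A + B) /
  -- (A + B₀)` is near `1`. So `e` is constant, while `e J - e 0 = 2πi(d' - d)`.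
  let e : ℕ → ℂ := fun j => L' (j / J) - L (j / J) -
    Complex.log ((A ((j / J : ℝ) : UnitAddCircle) + B ((j / J : ℝ) : UnitAddCircle)) /
      A ((j / J : ℝ) : UnitAddCircle))
  have hstep : ∀ j < J, e (j + 1) = e j := by
    intro j hj
    obtain ⟨H, hHc, hHe, hH0, hH1⟩ := hside j hj
    set y₀ : ℝ := j / J with hy₀
    set y₁ : ℝ := (j + 1 : ℕ) / J with hy₁
    have hy : y₀ ≤ y₁ := by
      rw [hy₀, hy₁]; gcongr; omega
    set B₀ := B (y₀ : UnitAddCircle) with hB₀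
    have hrpos : ∀ x ∈ Set.Icc y₀ y₁, ‖A (x : UnitAddCircle) + B x - (A x + B₀)‖ ≤
        ‖A (x : UnitAddCircle) + B₀‖ / 4 := by
      intro x hx
      have h1 := hosc j hj x hx
      have h2 := hr x
      have h3 := norm_le_norm_add_norm_sub' (A (x : UnitAddCircle) + B x) (A x + B₀)
      rw [add_sub_add_left_eq_sub] at h3 ⊢
      linarith
    have hAB : ∀ x ∈ Set.Icc y₀ y₁, A (x : UnitAddCircle) + B₀ ≠ 0 := by
      intro x hx h0
      have h1 := hHe x hx ▸ Complex.exp_ne_zero (H x)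
      apply h1
      simp [h0]
    have hlogc : ContinuousOn (fun x : ℝ => Complex.log ((A (x : UnitAddCircle) + B x) /
        (A x + B₀))) (Set.Icc y₀ y₁) := by
      refine ContinuousOn.clog (ContinuousOn.div (by fun_prop) (by fun_prop) hAB) fun x hx => ?_
      apply mem_slitPlane_div
      have := norm_pos_iff.mpr (hAB x hx)
      linarith [hrpos x hx]
    have hD := eq_of_exp_eq_one isPreconnected_Icc
      (f := fun x : ℝ => L' x - L x - H x -
        Complex.log ((A (x : UnitAddCircle) + B x) / (A x + B₀)))
      (((hLc'.sub hLc).continuousOn.sub hHc).sub hlogc) (fun x hx => by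
        have n1 := hAB x hx
        have n2 := hA0 x
        have n3 := hC0 x
        rw [Complex.exp_sub, Complex.exp_sub, Complex.exp_sub, hLe, hLe', hHe x hx,
          Complex.exp_log (div_ne_zero n3 n1)]
        simp only [sub_neg_eq_add, sub_zero]
        field_simp)
      (Set.right_mem_Icc.mpr hy) (Set.left_mem_Icc.mpr hy)
    simp only [sub_neg_eq_add, sub_zero] at hH0 hH1
    simp only [hH0, hH1] at hD
    have hself : Complex.log ((A (y₀ : UnitAddCircle) + B (y₀ : UnitAddCircle)) /
        (A (y₀ : UnitAddCircle) + B₀)) = 0 := by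
      rw [← hB₀, div_self (hAB y₀ (Set.left_mem_Icc.mpr hy)), Complex.log_one]
    have hmem := Set.right_mem_Icc.mpr hy
    have htrans := log_div_trans (hA0 y₁) (hAB y₁ hmem) (hC0 y₁) (by
      have h1 := norm_log_div_sub_le (v := A (y₁ : UnitAddCircle)) (p := 0) (q := -B₀) (M := M)
        (by simpa using hM.le) (by simpa using hBM _) (hfar (j + 1) hj)
        (norm_pos_iff.mpr (hA0 _))
      simp only [sub_neg_eq_add, sub_zero] at h1
      have h2 := norm_log_div_le_of_quarter (hAB y₁ hmem) (hrpos y₁ hmem)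
      linarith)
    change L' y₁ - L y₁ - Complex.log ((A (y₁ : UnitAddCircle) + B (y₁ : UnitAddCircle)) /
      A (y₁ : UnitAddCircle)) = L' y₀ - L y₀ - Complex.log ((A (y₀ : UnitAddCircle) +
        B (y₀ : UnitAddCircle)) / A (y₀ : UnitAddCircle))
    rw [htrans, ← hB₀]
    linear_combination hD - hself
  have hconst : ∀ j ≤ J, e j = e 0 := by
    intro j hj
    induction j with
    | zero => rfl
    | succ j ih => rw [hstep j hj, ih (by omega)]
  have hend := hconst J le_rfl
  have h1 : ((1 : ℝ) : UnitAddCircle) = ((0 : ℝ) : UnitAddCircle) := by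
    simp
  have hL1 := hLp 0
  have hL1' := hLp' 0
  simp only [e, div_self hJ'.ne', Nat.cast_zero, zero_div, h1] at hend
  rw [zero_add] at hL1 hL1'
  rw [hL1, hL1'] at hend
  have hne : (2 * Real.pi * Complex.I : ℂ) ≠ 0 := Complex.two_pi_I_ne_zero
  have : ((d : ℂ) - d') * (2 * Real.pi * Complex.I) = 0 := by linear_combination -hend
  rcases mul_eq_zero.mp this with h | h
  · exact_mod_cast sub_eq_zero.mp h
  · exact absurd h hne

/-! ### Escaping cocycles and their winding numbers. -/

/-- Twisted sums at return times are bounded away from zero, and the cocycle moves little at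
return times. -/
structure IsEscaping (E : ℂ) (a : UnitAddCircle) (f : UnitAddCircle → ℂ) (r ε : ℝ) : Prop where
  r_pos : 0 < r
  ε_pos : 0 < ε
  le_norm : ∀ n, 1 ≤ n → IsReturn E a ε n → ∀ x, r ≤ ‖twistedSum E a f n x‖
  step_le : ∀ n, IsReturn E a ε n → ∀ x, ‖E ^ n * f (x + n • a) - f x‖ ≤ r / 8

theorem norm_twistedSum_step_le {E : ℂ} (hE : ‖E‖ = 1) {a : UnitAddCircle}
    {f : UnitAddCircle → ℂ} {n : ℕ} {η : ℝ} (h : ∀ x, ‖E ^ n * f (x + n • a) - f x‖ ≤ η)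
    (x : UnitAddCircle) :
    ‖E * twistedSum E a f n (x + a) - twistedSum E a f n x‖ ≤ η := by
  have h1 := twistedSum_shift E a f 1 n x
  rw [pow_one, one_smul] at h1
  rw [h1, add_sub_cancel_left]
  simpa using norm_twistedSum_sub_le_mul hE a f h 1 x

/-- Infinitely many bounded values would include two close ones, at times `n < m`; their difference
has the norm of a twisted sum at the return time `m - n`, which is at least `r`. -/
theorem IsEscaping.exists_far {E : ℂ} (hE : ‖E‖ = 1) {a : UnitAddCircle} {f : UnitAddCircle → ℂ}
    {r ε : ℝ} (h : IsEscaping E a f r ε) (R : ℝ) (x : UnitAddCircle) :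
    ∃ N, ∀ n ≥ N, IsReturn E a (ε / 2) n → R < ‖twistedSum E a f n x‖ := by
  by_contra hcon
  push Not at hcon
  have hr := h.r_pos
  let S : Set ℕ := {n | IsReturn E a (ε / 2) n ∧ ‖twistedSum E a f n x‖ ≤ R}
  have hS : S.Infinite := Set.infinite_of_forall_exists_gt fun N => by
    obtain ⟨n, hn, h1, h2⟩ := hcon (N + 1)
    exact ⟨n, ⟨h1, h2⟩, by omega⟩
  obtain ⟨t, -, htf, hcov⟩ := (isCompact_closedBall (0 : ℂ) R).finite_cover_balls (e := r / 2)
    (by positivity)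
  have hmem : ∀ n ∈ S, ∃ c ∈ t, twistedSum E a f n x ∈ Metric.ball c (r / 2) := by
    intro n hn
    simpa using hcov (mem_closedBall_zero_iff.mpr hn.2)
  choose! F hF hFb using hmem
  obtain ⟨n, hn, m, hm, hnm, hFe⟩ := hS.exists_ne_map_eq_of_mapsTo hF htf
  wlog hlt : n < m generalizing n m
  · exact this m hm n hn hnm.symm hFe.symm (by omega)
  have hret := IsReturn.sub hE hn.1 hm.1 hlt.le
  have h1 := h.le_norm (m - n) (by omega) hret (x + n • a)
  have h2 := twistedSum_add E a f n (m - n) x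
  rw [Nat.add_sub_of_le hlt.le] at h2
  have h3 := dist_triangle_right (twistedSum E a f m x) (twistedSum E a f n x) (F n)
  have h4 := hFb n hn
  have h5 := hFb m hm
  rw [← hFe] at h5
  rw [Metric.mem_ball] at h4 h5
  rw [dist_eq_norm, h2, add_sub_cancel_left, norm_mul, norm_pow, hE, one_pow, one_mul, ← h2] at h3
  linarith

theorem exists_unif_cont_of_le {h : ℕ → UnitAddCircle → ℂ} (hh : ∀ n, Continuous (h n)) {η : ℝ}
    (hη : 0 < η) (K : ℕ) :
    ∃ δ > 0, ∀ b ≤ K, ∀ x y : UnitAddCircle, ‖x - y‖ < δ → ‖h b x - h b y‖ < η := by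
  induction K with
  | zero =>
    obtain ⟨δ, hδ, H⟩ := exists_unif_cont (hh 0) hη
    exact ⟨δ, hδ, fun b hb => by rw [Nat.le_zero.mp hb]; exact H⟩
  | succ K ih =>
    obtain ⟨δ, hδ, H⟩ := exists_unif_cont (hh (K + 1)) hη
    obtain ⟨δ', hδ', H'⟩ := ih
    refine ⟨min δ δ', lt_min hδ hδ', fun b hb x y hxy => ?_⟩
    rcases Nat.le_succ_iff.mp hb with hb | rfl
    · exact H' b hb x y (hxy.trans_le (min_le_right _ _))
    · exact H x y (hxy.trans_le (min_le_left _ _))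

theorem exists_nat_forall_le {p : ℕ → ℕ → Prop} (h : ∀ j, ∃ N, ∀ n ≥ N, p j n) (J : ℕ) :
    ∃ N, ∀ n ≥ N, ∀ j ≤ J, p j n := by
  choose N hN using h
  refine ⟨(Finset.range (J + 1)).sup N, fun n hn j hj => hN j n (le_trans ?_ hn)⟩
  exact Finset.le_sup (f := N) (Finset.mem_range.mpr (by omega))

/-- Adding a fixed return time does not change the winding number of late twisted sums. -/
theorem IsEscaping.exists_winding_eq {α β : ℝ} (hirr : ∀ d k : ℤ, (d * α - β - k : ℝ) ≠ 0)
    {f : UnitAddCircle → ℂ} (hf : Continuous f) {r ε : ℝ} {E : ℂ}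
    (hEdef : E = Complex.exp (-(2 * Real.pi * Complex.I * β))) (hE : ‖E‖ = 1)
    (h : IsEscaping E (α : UnitAddCircle) f r ε) {l : ℕ} (hl : 1 ≤ l)
    (hlret : IsReturn E (α : UnitAddCircle) ε l) :
    ∃ N, ∀ n ≥ N, IsReturn E (α : UnitAddCircle) (ε / 2) n →
      IsReturn E (α : UnitAddCircle) (ε / 2) (n + l) →
      ∀ d d', HasWinding (twistedSum E α f n) d → HasWinding (twistedSum E α f (n + l)) d' →
        d = d' := by
  set a : UnitAddCircle := (α : UnitAddCircle) with ha
  have hr := h.r_pos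
  have hε := h.ε_pos
  have hE0 : E ≠ 0 := norm_pos_iff.mp (by rw [hE]; exact one_pos)
  have huc := continuous_twistedSum E a hf
  have hul := h.le_norm l hl hlret
  obtain ⟨dl, hdl⟩ := exists_hasWinding (huc l) fun x => norm_pos_iff.mp (hr.trans_le (hul x))
  obtain ⟨k, G, hrot⟩ := hdl.exists_rotation (α := α) (β := β) (huc l) (fun x => by
    rw [← hEdef]
    have h1 := norm_twistedSum_step_le hE (h.step_le l hlret) x
    linarith [hul x])
  rw [← hEdef] at hrot
  have hX : (2 * Real.pi * Complex.I * (dl * α - β - k) : ℂ) ≠ 0 :=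
    mul_ne_zero Complex.two_pi_I_ne_zero (by exact_mod_cast hirr dl k)
  obtain ⟨R, hR0, hR⟩ := exists_bound_of_continuous (huc l)
  -- The constants `K`, `δ`, `J'`, `M` depend only on `l` and not on `n`. This is what allows `n` to
  -- be taken so large that `u n` exceeds `20 * M` at all nodes.
  obtain ⟨K, hK⟩ := exists_length_bound r R G hr _ hX
  obtain ⟨δ, hδ, hδu⟩ := exists_unif_cont_of_le huc (show (0 : ℝ) < r / 16 by positivity) (max K l)
  obtain ⟨J, hJ⟩ := exists_nat_one_div_lt hδ
  set J' : ℕ := J + 1 with hJ'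
  have hJpos : (0 : ℝ) < J' := by positivity
  have hJδ : 1 / (J' : ℝ) < δ := by rw [hJ']; push_cast; exact hJ
  set M : ℝ := R + K * (r / 8) + r with hM
  have hMpos : 0 < M := by positivity
  obtain ⟨N, hN⟩ := exists_nat_forall_le
    (fun j => h.exists_far hE (20 * M) ((j / J' : ℝ) : UnitAddCircle)) J'
  refine ⟨max N 1, fun n hn hret hret' d d' hd hd' => ?_⟩
  have hnN : N ≤ n := (le_max_left _ _).trans hn
  have hn1 : 1 ≤ n := (le_max_right _ _).trans hn
  have hretε := hret.mono (by linarith : ε / 2 ≤ ε)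
  have hretε' := hret'.mono (by linarith : ε / 2 ≤ ε)
  let u := twistedSum E a f
  let B : UnitAddCircle → ℂ := fun x => E ^ n * u l (x + n • a)
  have hBc : Continuous B := by
    have := huc l
    fun_prop
  have hBR : ∀ x, ‖B x‖ ≤ R := fun x => by
    simp only [B, norm_mul, norm_pow, hE, one_pow, one_mul]
    exact hR _
  have hsum : ∀ x, u (n + l) x = u n x + B x := fun x => twistedSum_add E a f n l x
  have hBosc : ∀ x y : UnitAddCircle, ‖x - y‖ < δ → ‖B x - B y‖ ≤ r / 16 := by
    intro x y hxy
    simp only [B]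
    rw [← mul_sub, norm_mul, norm_pow, hE, one_pow, one_mul]
    exact (hδu l (le_max_right _ _) _ _ (by simpa using hxy)).le
  have hclose : ∀ j < J', ∀ x ∈ Set.Icc (j / J' : ℝ) ((j + 1 : ℕ) / J' : ℝ),
      ‖(x : UnitAddCircle) - ((j / J' : ℝ) : UnitAddCircle)‖ < δ := by
    intro j hj x hx
    rw [← AddCircle.coe_sub]
    refine (norm_coe_le_abs _).trans_lt ?_
    rw [abs_of_nonneg (by linarith [hx.1])]
    have h2 := hx.2
    push_cast at h2
    rw [add_div] at h2
    linarith
  by_contra hdd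
  have hside : ∃ j < J', ¬ SameSide (fun t => u n (t : UnitAddCircle)) (j / J')
      ((j + 1 : ℕ) / J') 0 (-B ((j / J' : ℝ) : UnitAddCircle)) := by
    by_contra hcon
    push Not at hcon
    refine hdd (hd.eq_of_sameSide (A := u n) (B := B) (r := r) (M := M) (huc n) hBc ?_
      (Nat.succ_pos J) hMpos ?_ ?_ ?_ ?_ hcon)
    · have e : (fun x => u n x + B x) = u (n + l) := funext fun x => (hsum x).symm
      rw [e]; exact hd'
    · intro x
      rw [← hsum]
      exact h.le_norm _ (by omega) hretε' x
    · intro x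
      have : 0 ≤ K * (r / 8) := by positivity
      linarith [hBR x]
    · intro j hj
      exact (hN n hnN j hj hret).le
    · intro j hj x hx
      linarith [hBosc _ _ (hclose j hj x hx)]
  obtain ⟨j, hj, hside⟩ := hside
  set y₀ : ℝ := j / J' with hy₀
  set y₁ : ℝ := (j + 1 : ℕ) / J' with hy₁
  let Ψ : ℕ → ℕ → UnitAddCircle → ℂ := fun m b x => E ^ m * u b (x + m • a) - u b x
  have hΨ : ∀ m b x, E ^ b * u m (x + b • a) = u m x + Ψ m b x := fun m b x =>
    twistedSum_shift E a f b m x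
  have hΨosc : ∀ m, ∀ b ≤ K, ∀ x y : UnitAddCircle, ‖x - y‖ < δ → ‖Ψ m b x - Ψ m b y‖ ≤ r / 8 := by
    intro m b hb x y hxy
    have hb' : b ≤ max K l := hb.trans (le_max_left _ _)
    have h1 := hδu b hb' (x + m • a) (y + m • a) (by simpa using hxy)
    have h2 := hδu b hb' x y hxy
    have e : Ψ m b x - Ψ m b y = E ^ m * (u b (x + m • a) - u b (y + m • a)) -
        (u b x - u b y) := by simp only [Ψ]; ring
    rw [e]
    refine (norm_sub_le _ _).trans ?_
    rw [norm_mul, norm_pow, hE, one_pow, one_mul]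
    linarith
  have hnorm : ∀ m b x, ‖E ^ b * u m (x + b • a)‖ = ‖u m (x + b • a)‖ := fun m b x => by
    rw [norm_mul, norm_pow, hE, one_pow, one_mul]
  have hΨbound : ∀ m, IsReturn E a ε m → ∀ b ≤ K, ∀ x, ‖Ψ m b x‖ ≤ K * (r / 8) := by
    intro m hm b hb x
    refine (norm_twistedSum_sub_le_mul hE a f (h.step_le m hm) b x).trans ?_
    gcongr
  -- Up to oscillations over the arc, `u n x - P b` is `E ^ b * u n (x + b • a)` and `u n x - P' b`
  -- is `E ^ b * u (n + l) (x + b • a)`. Both have norm at least `r`, so the arc stays away from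
  -- both paths.
  let P : ℕ → ℂ := fun b => -Ψ n b y₀
  let P' : ℕ → ℂ := fun b => -(B y₀ + Ψ (n + l) b y₀)
  have hPP' : ∀ b, P' b - P b = -(E ^ b * (E ^ n * u l ((y₀ : UnitAddCircle) + n • a + b • a))) := by
    intro b
    have h1 := hΨ n b y₀
    have h2 := hΨ (n + l) b y₀
    rw [hsum, hsum] at h2
    simp only [B] at h2
    simp only [P, P', B]
    rw [add_right_comm]
    linear_combination h2 - h1
  refine lt_irrefl K (hK (fun t => u n (t : UnitAddCircle)) y₀ y₁ M P P' K ?_ ?_ ?_)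
  · exact
    { le := by rw [hy₀, hy₁]; gcongr; omega
      cont := ((huc n).comp (AddCircle.continuous_mk' 1)).continuousOn
      pos := hr
      avoid := fun x hx b hb => by
        have h1 := h.le_norm n hn1 hretε ((x : UnitAddCircle) + b • a)
        rw [← hnorm n b x, hΨ] at h1
        have h2 := hΨosc n b hb _ _ (hclose j hj x hx)
        have h3 := norm_le_norm_add_norm_sub' (u n (x : UnitAddCircle) + Ψ n b x)
          (u n (x : UnitAddCircle) + Ψ n b y₀)
        rw [add_sub_add_left_eq_sub] at h3
        simp only [P, sub_neg_eq_add]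
        linarith
      avoid' := fun x hx b hb => by
        have h1 := h.le_norm (n + l) (by omega) hretε' ((x : UnitAddCircle) + b • a)
        rw [← hnorm (n + l) b x, hΨ, hsum] at h1
        have h2 := hΨosc (n + l) b hb _ _ (hclose j hj x hx)
        have h2' := hBosc _ _ (hclose j hj x hx)
        have h3 := norm_le_norm_add_norm_sub' (u n (x : UnitAddCircle) + B x + Ψ (n + l) b x)
          (u n (x : UnitAddCircle) + (B y₀ + Ψ (n + l) b y₀))
        have e : u n (x : UnitAddCircle) + B x + Ψ (n + l) b x -
            (u n (x : UnitAddCircle) + (B y₀ + Ψ (n + l) b y₀)) =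
            (B x - B y₀) + (Ψ (n + l) b x - Ψ (n + l) b y₀) := by ring
        rw [e] at h3
        have h4 := norm_add_le (B x - B y₀) (Ψ (n + l) b x - Ψ (n + l) b y₀)
        simp only [P', sub_neg_eq_add]
        linarith
      step := fun b hb => by
        have h1 := norm_twistedSum_sub_le hE a f (h.step_le n hretε) b y₀
        simp only [P]
        rw [neg_sub_neg, norm_sub_rev]
        exact h1
      step' := fun b hb => by
        have h1 := norm_twistedSum_sub_le hE a f (h.step_le _ hretε') b y₀
        simp only [P']
        rw [neg_sub_neg, norm_sub_rev, add_sub_add_left_eq_sub]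
        exact h1
      bound := fun b hb => by
        have h1 := hΨbound n hretε b hb y₀
        simp only [P, norm_neg]
        linarith
      bound' := fun b hb => by
        have h1 := hΨbound _ hretε' b hb y₀
        have h2 := norm_add_le (B y₀) (Ψ (n + l) b y₀)
        simp only [P', norm_neg]
        linarith [hBR y₀]
      far := (hN n hnN j hj.le hret).le
      far' := (hN n hnN (j + 1) hj hret).le
      not_sameSide := by
        have e0 : P 0 = 0 := by simp [P, Ψ, u, twistedSum]
        have e0' : P' 0 = -B y₀ := by simp [P', Ψ, u, twistedSum]
        rw [e0, e0']
        exact hside }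
  · intro b hb
    rw [hPP', norm_neg, norm_mul, norm_mul, norm_pow, norm_pow, hE, one_pow, one_pow, one_mul,
      one_mul]
    exact hR _
  · intro s m hsm
    have h1 := hrot m ((y₀ : UnitAddCircle) + n • a + s • a)
    refine le_trans (le_of_eq ?_) h1
    congr 2
    refine Finset.sum_congr rfl fun b _ => ?_
    rw [hPP', hPP', neg_div_neg_eq, pow_succ, mul_assoc, mul_div_mul_left _ _ (pow_ne_zero _ hE0),
      mul_left_comm, mul_div_mul_left _ _ (pow_ne_zero _ hE0)]
    simp only [add_smul, add_assoc, u]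
    rfl

theorem exists_pos_le_abs_sub_int {θ : ℝ} (h : ∀ k : ℤ, (θ - k : ℝ) ≠ 0) :
    ∃ c > 0, ∀ k : ℤ, c ≤ |θ - k| :=
  ⟨|θ - round θ|, abs_pos.mpr (h _), fun k => round_le θ k⟩

theorem exists_pos_le_abs_of_finite {S : Set ℤ} (hS : S.Finite) {θ : ℤ → ℝ}
    (h : ∀ d k : ℤ, (θ d - k : ℝ) ≠ 0) : ∃ c > 0, ∀ d ∈ S, ∀ k : ℤ, c ≤ |θ d - k| := by
  induction S, hS using Set.Finite.induction_on with
  | empty => exact ⟨1, one_pos, by simp⟩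
  | @insert d S _ _ ih =>
    obtain ⟨c, hc, H⟩ := ih
    obtain ⟨c', hc', H'⟩ := exists_pos_le_abs_sub_int (h d)
    refine ⟨min c c', lt_min hc hc', fun d' hd' k => ?_⟩
    rcases hd' with rfl | hd'
    · exact (min_le_right _ _).trans (H' k)
    · exact (min_le_left _ _).trans (H d' hd' k)

section

variable {α β : ℝ} {f : UnitAddCircle → ℂ} {r ε : ℝ} {E : ℂ}

/-- Only finitely many winding numbers occur among the twisted sums at return times. -/
theorem IsEscaping.finite_winding (hirr : ∀ d k : ℤ, (d * α - β - k : ℝ) ≠ 0)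
    (hf : Continuous f) (hEdef : E = Complex.exp (-(2 * Real.pi * Complex.I * β)))
    (hE : ‖E‖ = 1) (h : IsEscaping E (α : UnitAddCircle) f r ε) :
    ∃ S : Set ℤ, S.Finite ∧ ∀ n, 1 ≤ n → IsReturn E (α : UnitAddCircle) (ε / 2) n →
      ∃ d ∈ S, HasWinding (twistedSum E α f n) d := by
  have hε := h.ε_pos
  have hwind : ∀ n, 1 ≤ n → IsReturn E (α : UnitAddCircle) (ε / 2) n →
      ∃ d, HasWinding (twistedSum E α f n) d := fun n hn hret =>
    exists_hasWinding (continuous_twistedSum E _ hf n) fun x => norm_pos_iff.mp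
      (h.r_pos.trans_le (h.le_norm n hn (hret.mono (by linarith)) x))
  choose! d hd using hwind
  obtain ⟨K, hK⟩ := exists_isReturn_sub hE (α : UnitAddCircle) (half_pos hε)
  obtain ⟨N, hN⟩ := exists_nat_forall_le (p := fun j n => IsReturn E (α : UnitAddCircle) ε (j + 1) →
      IsReturn E (α : UnitAddCircle) (ε / 2) n →
      IsReturn E (α : UnitAddCircle) (ε / 2) (n + (j + 1)) →
      ∀ d d', HasWinding (twistedSum E α f n) d →
        HasWinding (twistedSum E α f (n + (j + 1))) d' → d = d') (fun j => by
    by_cases hj : IsReturn E (α : UnitAddCircle) ε (j + 1)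
    · obtain ⟨N, hN⟩ := h.exists_winding_eq hirr hf hEdef hE (Nat.le_add_left 1 j) hj
      exact ⟨N, fun n hn _ => hN n hn⟩
    · exact ⟨0, fun n _ h' => absurd h' hj⟩) K
  refine ⟨d '' Set.Iic (N + K + 1), (Set.finite_Iic _).image d, fun n hn hret =>
    ⟨d n, ?_, hd n hn hret⟩⟩
  induction n using Nat.strong_induction_on with
  | _ n ih =>
    rcases le_or_gt n (N + K + 1) with hle | hlt
    · exact ⟨n, hle, rfl⟩
    -- Starting from `n - 1` gives a return time strictly below `n`, at distance `j + 1 ≤ K + 1`,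
    -- with the same winding number.
    · obtain ⟨j, hjK, hjn, hj⟩ := hK (n - 1)
      have e : n - 1 - j + (j + 1) = n := by omega
      have hl := IsReturn.sub hE hj hret (by omega)
      rw [show n - (n - 1 - j) = j + 1 by omega] at hl
      have h1 := hN (n - 1 - j) (by omega) j hjK hl hj (by rwa [e])
        (d (n - 1 - j)) (d n) (hd _ (by omega) hj) (by rw [e]; exact hd n hn hret)
      rw [← h1]
      exact ih _ (by omega) (by omega) hj

theorem IsEscaping.false (hirr : ∀ d k : ℤ, (d * α - β - k : ℝ) ≠ 0)
    (hf : Continuous f) (hEdef : E = Complex.exp (-(2 * Real.pi * Complex.I * β)))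
    (hE : ‖E‖ = 1) (h : IsEscaping E (α : UnitAddCircle) f r ε) : False := by
  have hr := h.r_pos
  obtain ⟨S, hS, hSw⟩ := h.finite_winding hirr hf hEdef hE
  obtain ⟨c, hc, hcS⟩ := exists_pos_le_abs_of_finite hS (θ := fun d => d * α - β) hirr
  -- The bound `r * c / 3` makes each logarithm at most `c / 2`, whereas the mean rate is at least
  -- `2πc`.
  set η : ℝ := min (r / 4) (r * c / 3) with hη
  have hη0 : 0 < η := by positivity
  obtain ⟨ε', hε', H⟩ := exists_isReturn_norm_sub_le (E := E) (α : UnitAddCircle) hf hη0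
  obtain ⟨n, hn1, hn⟩ := exists_isReturn_ge hE (α : UnitAddCircle)
    (lt_min hε' (half_pos h.ε_pos)) 1
  have hret := hn.mono (min_le_right ε' (ε / 2))
  obtain ⟨d, hdS, hd⟩ := hSw n hn1 hret
  have hlow := h.le_norm n hn1 (hret.mono (by linarith [h.ε_pos]))
  have hstep := norm_twistedSum_step_le hE (H n (hn.mono (min_le_left _ _)))
  have hη4 : ∀ x, η ≤ ‖twistedSum E α f n x‖ / 4 := fun x => by
    linarith [hlow x, min_le_left (r / 4) (r * c / 3)]
  obtain ⟨k, G, hrot⟩ := hd.exists_rotation (α := α) (β := β) (continuous_twistedSum E _ hf n)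
    (fun x => by rw [← hEdef]; exact (hstep x).trans (hη4 x))
  rw [← hEdef] at hrot
  have hlog : ∀ x, ‖Complex.log (E * twistedSum E α f n (x + α) / twistedSum E α f n x)‖ ≤
      c / 2 := by
    intro x
    have hx : 0 < ‖twistedSum E α f n x‖ := hr.trans_le (hlow x)
    refine (norm_log_div_le (norm_pos_iff.mp hx) (by linarith [hstep x, hη4 x])).trans ?_
    have : ‖E * twistedSum E α f n (x + α) - twistedSum E α f n x‖ / ‖twistedSum E α f n x‖ ≤
        c / 3 := by
      rw [div_le_iff₀ hx]
      nlinarith [hstep x, min_le_right (r / 4) (r * c / 3), hlow x]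
    linarith
  have hle := norm_le_of_forall_mul_le (c := ‖(2 * Real.pi * Complex.I * (d * α - β - k) : ℂ)‖)
    (η := c / 2) (G := G) fun m => by
    have h1 := hrot m 0
    have h2 := norm_sum_le_of_le (Finset.range m) fun b (_ : b ∈ Finset.range m) =>
      hlog (0 + b • (α : UnitAddCircle))
    rw [Finset.sum_const, Finset.card_range, nsmul_eq_mul] at h2
    simp only [add_assoc, ← succ_nsmul] at h2
    have h3 := norm_le_norm_add_norm_sub (∑ b ∈ Finset.range m, Complex.log
      (E * twistedSum E α f n (0 + (b + 1) • (α : UnitAddCircle)) /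
        twistedSum E α f n (0 + b • (α : UnitAddCircle))))
      (m * (2 * Real.pi * Complex.I * (d * α - β - k)))
    rw [norm_mul, Complex.norm_natCast] at h3
    linarith
  have h1 := hcS d hdS k
  have e : ‖(2 * Real.pi * Complex.I * (d * α - β - k) : ℂ)‖ = 2 * Real.pi * |d * α - β - k| := by
    have : (d * α - β - k : ℂ) = ((d * α - β - k : ℝ) : ℂ) := by push_cast; ring
    rw [this, norm_mul, Complex.norm_real, Real.norm_eq_abs]
    simp [abs_of_pos Real.pi_pos]
  rw [e] at hle
  nlinarith [Real.pi_gt_three]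

end

/-! ### From a wandering open set to an escaping cocycle. -/

theorem zero_of_linearIndependent {α β : ℝ} (h : LinearIndependent ℚ ![(1 : ℝ), α, β]) {p q s : ℤ}
    (hpq : (p + q * α + s * β : ℝ) = 0) : p = 0 ∧ q = 0 ∧ s = 0 := by
  have h1 := Fintype.linearIndependent_iff.mp h ![(p : ℚ), q, s] (by
    simpa [Fin.sum_univ_three, Rat.smul_def] using hpq)
  have e0 := h1 0
  have e1 := h1 1
  have e2 := h1 2
  simp only [Matrix.cons_val] at e0 e1 e2
  exact ⟨by exact_mod_cast e0, by exact_mod_cast e1, by exact_mod_cast e2⟩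

theorem mul_sub_sub_ne_zero {α β : ℝ} (h : LinearIndependent ℚ ![(1 : ℝ), α, β]) (d k : ℤ) :
    (d * α - β - k : ℝ) ≠ 0 := fun h0 => by
  have := (zero_of_linearIndependent h (p := -k) (q := d) (s := -1)
    (by push_cast; linarith)).2.2
  omega

theorem irrational_of_linearIndependent {α β : ℝ} (h : LinearIndependent ℚ ![(1 : ℝ), α, β]) :
    Irrational α := by
  rw [irrational_iff_ne_rational]
  rintro p q hq rfl
  have := (zero_of_linearIndependent h (p := -p) (q := q) (s := 0) (by
    have : (q : ℝ) ≠ 0 := by exact_mod_cast hq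
    field_simp
    push_cast
    ring)).2.1
  exact hq this

theorem exists_nsmul_near {α : ℝ} (hα : Irrational α) (x₀ : UnitAddCircle) {δ : ℝ} (hδ : 0 < δ) :
    ∃ M : ℕ, ∀ x : UnitAddCircle, ∃ m ≤ M, ‖x + m • (α : UnitAddCircle) - x₀‖ < δ := by
  have hd : DenseRange fun n : ℕ => n • (α : UnitAddCircle) := by
    rw [← denseRange_zsmul_iff_nsmul, AddCircle.denseRange_zsmul_coe_iff, div_one]
    exact hα
  obtain ⟨t, ht⟩ := isCompact_univ.elim_finite_subcover
    (fun m : ℕ => {x : UnitAddCircle | ‖x + m • (α : UnitAddCircle) - x₀‖ < δ})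
    (fun m => isOpen_lt (by fun_prop) continuous_const) fun x _ => by
      obtain ⟨m, hm⟩ := hd.exists_dist_lt (x₀ - x) hδ
      refine Set.mem_iUnion.mpr ⟨m, ?_⟩
      rw [dist_comm, dist_eq_norm] at hm
      rwa [Set.mem_ofPred_eq, show x + m • (α : UnitAddCircle) - x₀ = m • (α : UnitAddCircle) -
        (x₀ - x) by abel]
  refine ⟨t.sup id, fun x => ?_⟩
  obtain ⟨m, hm, hx⟩ := Set.mem_iUnion₂.mp (ht (Set.mem_univ x))
  exact ⟨m, Finset.le_sup (f := id) hm, hx⟩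

section

variable {α β : ℝ} {ρ : UnitAddCircle → ℂ} {E : ℂ}

theorem norm_exp_neg_two_pi_I_mul (β : ℝ) : ‖Complex.exp (-(2 * Real.pi * Complex.I * β))‖ = 1 := by
  rw [show (-(2 * Real.pi * Complex.I * β) : ℂ) = ((-(2 * Real.pi * β) : ℝ) : ℂ) * Complex.I by
    push_cast; ring]
  exact Complex.norm_exp_ofReal_mul_I _

theorem twistedSum_eq_vortexSum (hE : E = Complex.exp (-(2 * Real.pi * Complex.I * β))) (n : ℕ)
    (x : UnitAddCircle) :
    twistedSum E α (fun y => E * ρ y) n x = E ^ n * vortexSum α β ρ n x := by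
  have h1 : E * Complex.exp (2 * Real.pi * Complex.I * β) = 1 := by
    rw [hE, ← Complex.exp_add, neg_add_cancel, Complex.exp_zero]
  induction n with
  | zero => simp [twistedSum, vortexSum]
  | succ n ih =>
    have h2 : vortexSum α β ρ (n + 1) x = Complex.exp (2 * Real.pi * Complex.I * β) *
        vortexSum α β ρ n x + ρ (x + n • (α : UnitAddCircle)) := by
      rw [vortexSum, Function.iterate_succ_apply', vortex_iterate, vortex]
      simp
    have h3 : twistedSum E α (fun y => E * ρ y) (n + 1) x = twistedSum E α (fun y => E * ρ y) n x +
        E ^ n * (E * ρ (x + n • (α : UnitAddCircle))) := Finset.sum_range_succ _ _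
    rw [h3, ih, h2]
    linear_combination (-(E ^ n * vortexSum α β ρ n x)) * h1

theorem norm_vortexSum (hE : E = Complex.exp (-(2 * Real.pi * Complex.I * β))) (n : ℕ)
    (x : UnitAddCircle) :
    ‖vortexSum α β ρ n x‖ = ‖twistedSum E α (fun y => E * ρ y) n x‖ := by
  have hE1 : ‖E‖ = 1 := hE ▸ norm_exp_neg_two_pi_I_mul β
  rw [twistedSum_eq_vortexSum hE, norm_mul, norm_pow, hE1, one_pow, one_mul]

/-- A small `u_n(x)` at a return time, with `x` near `x₀`, would send `(x, z₀)` back into `U`.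
Minimality brings any `x` near `x₀` in at most `M` steps, which alter `u_n` by at most `δ / 4` in
norm. -/
theorem exists_isEscaping_of_isWanderingOpen (hα : Irrational α) (hρ : Continuous ρ)
    (hE : E = Complex.exp (-(2 * Real.pi * Complex.I * β))) {U : Set (UnitAddCircle × ℂ)}
    (hU : IsWanderingOpen (vortex α β ρ) U) :
    ∃ r ε, IsEscaping E (α : UnitAddCircle) (fun y => E * ρ y) r ε := by
  have hE1 : ‖E‖ = 1 := hE ▸ norm_exp_neg_two_pi_I_mul β
  obtain ⟨hUo, ⟨⟨x₀, z₀⟩, hmem⟩, hdis⟩ := hU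
  obtain ⟨δ, hδ, hball⟩ := Metric.isOpen_iff.mp hUo _ hmem
  have hfc : Continuous fun y => E * ρ y := by fun_prop
  obtain ⟨M, hM⟩ := exists_nsmul_near hα x₀ (half_pos hδ)
  obtain ⟨ε₁, hε₁, hstep⟩ := exists_isReturn_norm_sub_le (E := E) (α : UnitAddCircle) hfc
    -- The first bound is `r / 8` for `r = δ / 4`; the second keeps the total change over `M` steps
    -- below `δ / 4`.
    (show 0 < min (δ / 4 / 8) (δ / 4 / (M + 1)) by positivity)
  set ε : ℝ := min ε₁ (min (δ / 2) (δ / 2 / (‖z₀‖ + 1))) with hε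
  have hlocal : ∀ n, 1 ≤ n → IsReturn E (α : UnitAddCircle) ε n → ∀ x : UnitAddCircle,
      ‖x - x₀‖ < δ / 2 → δ / 2 ≤ ‖twistedSum E α (fun y => E * ρ y) n x‖ := by
    intro n hn hret x hx
    by_contra hlt
    push Not at hlt
    have hxU : (x, z₀) ∈ U := hball (by
      rw [Metric.mem_ball, Prod.dist_eq, max_lt_iff, dist_eq_norm]
      exact ⟨by linarith, by simpa using hδ⟩)
    refine Set.disjoint_left.mp (hdis n hn) ⟨_, hxU, rfl⟩ (hball ?_)
    rw [vortex_iterate, Metric.mem_ball, Prod.dist_eq, max_lt_iff, dist_eq_norm, dist_eq_norm]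
    have h1 := hret.1.trans_le ((min_le_right _ _).trans (min_le_left _ _))
    have h2 := hret.2.trans_le ((min_le_right _ _).trans (min_le_right _ _))
    constructor
    · have := norm_add_le (x - x₀) (n • (α : UnitAddCircle))
      rw [sub_add_eq_add_sub] at this
      linarith
    · have h3 : E ^ n * Complex.exp (2 * Real.pi * Complex.I * (n * β)) = 1 := by
        rw [hE, ← Complex.exp_nat_mul, ← Complex.exp_add, ← Complex.exp_zero]
        congr 1
        ring
      have h4 : E ^ n * (Complex.exp (2 * Real.pi * Complex.I * (n * β)) * z₀ +
          vortexSum α β ρ n x - z₀) = twistedSum E α (fun y => E * ρ y) n x -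
            (E ^ n - 1) * z₀ := by
        rw [twistedSum_eq_vortexSum hE]
        linear_combination z₀ * h3
      have h5 : ‖(E ^ n - 1) * z₀‖ ≤ δ / 2 := by
        rw [norm_mul]
        have : δ / 2 / (‖z₀‖ + 1) * (‖z₀‖ + 1) = δ / 2 := by field_simp
        nlinarith [norm_nonneg z₀, norm_nonneg (E ^ n - 1)]
      have h6 := congrArg norm h4
      rw [norm_mul, norm_pow, hE1, one_pow, one_mul] at h6
      change ‖Complex.exp (2 * Real.pi * Complex.I * (n * β)) * z₀ +
          vortexSum α β ρ n x - z₀‖ < δ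
      rw [h6]
      linarith [norm_sub_le (twistedSum E α (fun y => E * ρ y) n x) ((E ^ n - 1) * z₀)]
  refine ⟨δ / 4, ε, by positivity, by positivity, fun n hn hret x => ?_, fun n hret x =>
    (hstep n (hret.mono (min_le_left _ _)) x).trans (min_le_left _ _)⟩
  obtain ⟨m, hm, hx⟩ := hM x
  have h1 := hlocal n hn hret _ hx
  have h2 := norm_twistedSum_sub_le_mul hE1 (α : UnitAddCircle) (fun y => E * ρ y)
    (hstep n (hret.mono (min_le_left _ _))) m x
  have h3 := congrArg norm (twistedSum_shift E α (fun y => E * ρ y) m n x)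
  rw [norm_mul, norm_pow, hE1, one_pow, one_mul] at h3
  have h4 := norm_add_le (twistedSum E α (fun y => E * ρ y) n x)
    (E ^ n * twistedSum E α (fun y => E * ρ y) m (x + n • (α : UnitAddCircle)) -
      twistedSum E α (fun y => E * ρ y) m x)
  have h5 : (m : ℝ) * min (δ / 4 / 8) (δ / 4 / (M + 1)) ≤ δ / 4 := by
    have hm' : (m : ℝ) ≤ M := by exact_mod_cast hm
    calc (m : ℝ) * min (δ / 4 / 8) (δ / 4 / (M + 1)) ≤ (M + 1) * (δ / 4 / (M + 1)) := by
          gcongr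
          · linarith
          · exact min_le_right _ _
      _ = δ / 4 := by field_simp
  linarith

end

/-! ### Uniform vanishing of the twisted averages. -/

/-- The twisted Birkhoff averages of `f` tend to zero uniformly. -/
def HasZeroMean (E : ℂ) (a : UnitAddCircle) (f : UnitAddCircle → ℂ) : Prop :=
  ∀ η > 0, ∃ N, ∀ n ≥ N, ∀ x, ‖twistedSum E a f n x‖ ≤ n * η

section

variable {E : ℂ} {a : UnitAddCircle} {f g : UnitAddCircle → ℂ}

theorem twistedSum_add_fun (n : ℕ) (x : UnitAddCircle) :
    twistedSum E a (fun y => f y + g y) n x = twistedSum E a f n x + twistedSum E a g n x := by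
  simp only [twistedSum, mul_add, Finset.sum_add_distrib]

theorem twistedSum_const_mul (c : ℂ) (n : ℕ) (x : UnitAddCircle) :
    twistedSum E a (fun y => c * f y) n x = c * twistedSum E a f n x := by
  simp only [twistedSum, Finset.mul_sum, mul_left_comm]

theorem norm_twistedSum_le (hE : ‖E‖ = 1) {η : ℝ} (h : ∀ x, ‖f x‖ ≤ η) (n : ℕ)
    (x : UnitAddCircle) : ‖twistedSum E a f n x‖ ≤ n * η := by
  have := norm_sum_le_of_le (Finset.range n) (f := fun j => E ^ j * f (x + j • a))
    (n := fun _ => η) fun j _ => by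
      rw [norm_mul, norm_pow, hE, one_pow, one_mul]
      exact h _
  rwa [Finset.sum_const, Finset.card_range, nsmul_eq_mul] at this

theorem HasZeroMean.add (hf : HasZeroMean E a f) (hg : HasZeroMean E a g) :
    HasZeroMean E a fun x => f x + g x := by
  intro η hη
  obtain ⟨N, hN⟩ := hf (η / 2) (half_pos hη)
  obtain ⟨N', hN'⟩ := hg (η / 2) (half_pos hη)
  refine ⟨max N N', fun n hn x => ?_⟩
  rw [twistedSum_add_fun]
  have h1 := hN n ((le_max_left _ _).trans hn) x
  have h2 := hN' n ((le_max_right _ _).trans hn) x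
  linarith [norm_add_le (twistedSum E a f n x) (twistedSum E a g n x)]

theorem HasZeroMean.const_mul (hf : HasZeroMean E a f) (c : ℂ) :
    HasZeroMean E a fun x => c * f x := by
  intro η hη
  obtain ⟨N, hN⟩ := hf (η / (‖c‖ + 1)) (by positivity)
  refine ⟨N, fun n hn x => ?_⟩
  rw [twistedSum_const_mul, norm_mul]
  calc ‖c‖ * ‖twistedSum E a f n x‖ ≤ (‖c‖ + 1) * (n * (η / (‖c‖ + 1))) := by
        gcongr
        · linarith
        · exact hN n hn x
    _ = n * η := by field_simp

theorem HasZeroMean.of_approx (hE : ‖E‖ = 1)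
    (h : ∀ η > 0, ∃ g, HasZeroMean E a g ∧ ∀ x, ‖f x - g x‖ ≤ η) : HasZeroMean E a f := by
  intro η hη
  obtain ⟨g, hg, hfg⟩ := h (η / 2) (half_pos hη)
  obtain ⟨N, hN⟩ := hg (η / 2) (half_pos hη)
  refine ⟨N, fun n hn x => ?_⟩
  have e : twistedSum E a f n x = twistedSum E a (fun y => f y - g y) n x + twistedSum E a g n x := by
    rw [← twistedSum_add_fun]
    simp only [sub_add_cancel]
  rw [e]
  have h1 := norm_twistedSum_le (a := a) hE hfg n x
  linarith [norm_add_le (twistedSum E a (fun y => f y - g y) n x) (twistedSum E a g n x), hN n hn x]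

theorem hasZeroMean_fourier (hE : ‖E‖ = 1) {k : ℤ} (hk : E * fourier k a ≠ 1) :
    HasZeroMean E a (fourier k) := by
  intro η hη
  set w : ℂ := E * fourier k a with hw
  have hw1 : ‖w‖ = 1 := by
    rw [hw, norm_mul, hE, one_mul, fourier_apply, Circle.norm_coe]
  have hpos : 0 < ‖w - 1‖ := norm_pos_iff.mpr (sub_ne_zero.mpr hk)
  obtain ⟨N, hN⟩ := exists_nat_ge (2 / ‖w - 1‖ / η)
  refine ⟨N, fun n hn x => ?_⟩
  have hpow : ∀ j : ℕ, (fourier k (x + j • a) : ℂ) =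
      fourier k x * fourier k a ^ j := by
    intro j
    simp [fourier_apply, smul_add, AddCircle.toCircle_add, smul_comm k j, AddCircle.toCircle_nsmul]
  have e : twistedSum E a (fourier k) n x =
      fourier k x * ((w ^ n - 1) / (w - 1)) := by
    rw [← geom_sum_eq hk, Finset.mul_sum]
    refine Finset.sum_congr rfl fun j _ => ?_
    rw [hpow, hw, mul_pow]
    ring
  rw [e, norm_mul, norm_div, fourier_apply, Circle.norm_coe, one_mul]
  have h2 : ‖w ^ n - 1‖ ≤ 2 := by
    refine (norm_sub_le _ _).trans ?_
    rw [norm_pow, hw1, one_pow, norm_one]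
    norm_num
  have hn' : (N : ℝ) ≤ n := by exact_mod_cast hn
  rw [div_le_iff₀ hη] at hN
  calc ‖w ^ n - 1‖ / ‖w - 1‖ ≤ 2 / ‖w - 1‖ := by gcongr
    _ ≤ N * η := hN
    _ ≤ n * η := by gcongr

/-- The functions of zero mean form a uniformly closed linear space; it contains all characters. -/
theorem HasZeroMean.of_continuous (hE : ‖E‖ = 1) (hk : ∀ k : ℤ, E * fourier k a ≠ 1)
    (hf : Continuous f) : HasZeroMean E a f := by
  refine HasZeroMean.of_approx hE fun η hη => ?_
  have hmem : (⟨f, hf⟩ : C(UnitAddCircle, ℂ)) ∈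
      (Submodule.span ℂ (Set.range (@fourier 1))).topologicalClosure := by
    rw [span_fourier_closure_eq_top]
    trivial
  obtain ⟨g, hg, hd⟩ := Metric.mem_closure_iff.mp hmem η hη
  refine ⟨g, ?_, fun x => ?_⟩
  · clear hd
    induction hg using Submodule.span_induction with
    | mem g hg =>
      obtain ⟨k, rfl⟩ := hg
      exact hasZeroMean_fourier hE (hk k)
    | zero => exact fun η hη => ⟨0, fun n _ x => by simp [twistedSum]; positivity⟩
    | add g₁ g₂ _ _ h₁ h₂ => exact h₁.add h₂
    | smul c g _ h => exact h.const_mul c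
  · rw [← dist_eq_norm]
    exact (ContinuousMap.dist_apply_le_dist x).trans hd.le

end

theorem exp_mul_fourier_ne_one {α β : ℝ} (hirr : ∀ d k : ℤ, (d * α - β - k : ℝ) ≠ 0) (k : ℤ) :
    Complex.exp (-(2 * Real.pi * Complex.I * β)) * fourier k (α : UnitAddCircle) ≠ 1 := by
  rw [fourier_coe_apply, ← Complex.exp_add]
  intro h
  obtain ⟨m, hm⟩ := Complex.exp_eq_one_iff.mp h
  refine hirr k m ?_
  have : (2 * Real.pi * Complex.I : ℂ) * (k * α - β - m) = 0 := by
    push_cast at hm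
    linear_combination hm
  rcases mul_eq_zero.mp this with h | h
  · exact absurd h Complex.two_pi_I_ne_zero
  · exact_mod_cast h

theorem tendstoUniformly_vortexSum_div {α β : ℝ} (hirr : ∀ d k : ℤ, (d * α - β - k : ℝ) ≠ 0)
    {ρ : UnitAddCircle → ℂ} (hρ : Continuous ρ) :
    TendstoUniformly (fun (n : ℕ) (x : UnitAddCircle) => vortexSum α β ρ n x / (n : ℂ))
      (fun _ => 0) atTop := by
  rw [Metric.tendstoUniformly_iff]
  intro ε hε
  obtain ⟨N, hN⟩ := HasZeroMean.of_continuous (norm_exp_neg_two_pi_I_mul β)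
    (exp_mul_fourier_ne_one hirr)
    (f := fun y => Complex.exp (-(2 * Real.pi * Complex.I * β)) * ρ y) (by fun_prop) (ε / 2)
    (half_pos hε)
  filter_upwards [eventually_ge_atTop N, eventually_gt_atTop 0] with n hn hn0 x
  have h1 := hN n hn x
  rw [← norm_vortexSum rfl] at h1
  have hn' : (0 : ℝ) < n := by exact_mod_cast hn0
  rw [dist_zero_left, norm_div, Complex.norm_natCast, div_lt_iff₀ hn']
  nlinarith

theorem mainTheorem8 (α β : ℝ) (hαβ : LinearIndependent ℚ ![(1 : ℝ), α, β])
    (ρ : UnitAddCircle → ℂ) (hρ : Continuous ρ) :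
    TendstoUniformly (fun (n : ℕ) (x : UnitAddCircle) => vortexSum α β ρ n x / (n : ℂ))
        (fun _ => 0) atTop ∧
      HasZeroDrift α β ρ ∧
      IsTopConservative (vortex α β ρ) := by
  have hirr := mul_sub_sub_ne_zero hαβ
  have hunif := tendstoUniformly_vortexSum_div hirr hρ
  refine ⟨hunif, fun μ _ _ => ae_of_all _ fun x => ?_, fun U hU => ?_⟩
  · simpa using (hunif.tendsto_at x).norm
  · obtain ⟨r, ε, h⟩ := exists_isEscaping_of_isWanderingOpen (irrational_of_linearIndependent hαβ)
      hρ rfl hU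
    exact h.false hirr (by fun_prop) rfl (norm_exp_neg_two_pi_I_mul β)
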